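/- Let $\{X_t\}_{t\in\mathbb Z}$ be a strictly stationary Gaussian time series with values in $\mathbb R^m$, with mean $\mu$, autocovariances $\gamma(h)=E[(X_{t+h}-\mu)(X_t-\mu)']$ and spectral density matrix $f(w)=\frac1{2\pi}\sum_{h\in\mathbb Z}e^{-iwh}\gamma(h)$. Suppose that Assumption A(4) holds: $f$ is well defined (the series converges, in the sense of unconditional summability, for every $w$) and every entry $f_{jk}$ is four times continuously differentiable on $\mathbb R$. Fix $1\le j,k\le m$, a boundary frequency $\theta\in\{0,\pi\}$ and a bandwidth fraction $\delta\in(0,\tfrac12)$. For observations $X_1,\dots,X_n$ put $\bar X_n=n^{-1}\sum_{t=1}^nX_t$, $\hat\gamma(h)=n^{-1}\sum_{1\le t,\,t+h\le n}(X_{t+h}-\bar X_n)(X_t-\bar X_n)'$ (so $\hat\gamma(-h)=\hat\gamma(h)'$, and $\hat\gamma(h)=0$ for $|h|\ge n$), and let $I(w)=\frac1{2\pi}\sum_he^{-iwh}\hat\gamma(h)$ be the periodogram matrix. Let $w_s=2\pi s/n$, $M=[\delta n]$, and let $S_n$ be the set of $M$ indices $\{1,\dots,M\}$ if $\theta=0$,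 and $\{[n/2]-M+1,\dots,[n/2]\}$ if $\theta=\pi$. The OLS estimator $\tilde f_{jk}(\theta)=[1,0]\,(\mathbf X'\mathbf X)^{-1}\mathbf X'\mathbf Y$ is the intercept in the least squares regression of $\mathbf Y=(\mathrm{Re}\,I_{jk}(w_s))_{s\in S_n}$ on a constant and $(\theta-w_s)^2$; that is, $\mathbf X$ has rows $(1,(\theta-w_s)^2)$, $s\in S_n$. Define $$c_{2\ell}=\frac1M\sum_{s\in S_n}(\theta-w_s)^{2\ell},\qquad G_{2p}=\frac1M\sum_{s\in S_n}(\theta-w_s)^{2p}\,\mathrm{Re}\,f_{jk}(w_s),$$ $$F_{2p}=\frac1M\sum_{s\in S_n}(\theta-w_s)^{2p}\left(f_{jk}(w_s)^2+f_{kj}(w_s)^2+2f_{jj}(w_s)f_{kk}(w_s)\right).$$ Then $\tilde f_{jk}(\theta)$ is square integrable for every $n$ and, as $n\to\infty$ with $\delta$ fixed, $$\mathrm{Var}[\tilde f_{jk}(\theta)]=\delta^{-1}n^{-1}\,\frac{c_4^2F_0-2c_4c_2F_2+c_2^2F_4}{4(c_4-c_2^2)^2}+o(n^{-1}),$$ $$\mathrm{Bias}[\tilde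 f_{jk}(\theta)]=E[\tilde f_{jk}(\theta)]-f_{jk}(\theta)=\frac{c_4G_0-c_2G_2}{c_4-c_2^2}-f_{jk}(\theta)+O(n^{-1}).$$ -/

import Mathlib

open MeasureTheory ProbabilityTheory Filter Asymptotics
open scoped Matrix

noncomputable section

namespace BoundarySpec

variable {Ω : Type*} [MeasurableSpace Ω] {m : ℕ}

/-- Strict stationarity: all finite dimensional distributions are invariant under time shifts. -/
def IsStrictlyStationary (X : ℤ → Ω → (Fin m → ℝ)) (P : Measure Ω) : Prop :=
  ∀ (I : Finset ℤ) (h : ℤ),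
    IdentDistrib (fun ω (t : I) => X ((t : ℤ) + h) ω) (fun ω (t : I) => X (t : ℤ) ω) P P

/-- The `(j, k)` entry of the autocovariance matrix `γ(h)`, that is `Cov[X_{t+h,j}, X_{t,k}]`,
computed at `t = 0` (for a stationary series it does not depend on `t`). -/
def autocov (X : ℤ → Ω → (Fin m → ℝ)) (P : Measure Ω) (h : ℤ) : Matrix (Fin m) (Fin m) ℝ :=
  Matrix.of fun j k => covariance (fun ω => X h ω j) (fun ω => X 0 ω k) P

/-- The spectral density matrix `f(w) = (2π)⁻¹ ∑_{h ∈ ℤ} e^{-iwh} γ(h)`. -/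
def specDensity (X : ℤ → Ω → (Fin m → ℝ)) (P : Measure Ω) (w : ℝ) : Matrix (Fin m) (Fin m) ℂ :=
  Matrix.of fun j k =>
    (2 * (Real.pi : ℂ))⁻¹ *
      ∑' h : ℤ, Complex.exp (-Complex.I * (w : ℂ) * (h : ℂ)) * (autocov X P h j k : ℂ)

/-- Assumption A(p): the series defining the spectral density matrix converges at every frequency
(so that `f` is well defined) and every entry of `f` is `p` times continuously differentiable. -/
def AssumptionA (X : ℤ → Ω → (Fin m → ℝ)) (P : Measure Ω) (p : ℕ) : Prop :=
  ∀ j k : Fin m,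
    (∀ w : ℝ, Summable fun h : ℤ =>
      Complex.exp (-Complex.I * (w : ℂ) * (h : ℂ)) * (autocov X P h j k : ℂ)) ∧
    ContDiff ℝ p fun w : ℝ => specDensity X P w j k

/-- The sample mean `n⁻¹ ∑_{t=1}^n x_t` of (the first `n` terms of) a data sequence. -/
def sampleMean (x : ℤ → (Fin m → ℝ)) (n : ℕ) : Fin m → ℝ :=
  (n : ℝ)⁻¹ • ∑ t ∈ Finset.Icc (1 : ℤ) n, x t

/-- The sample autocovariance matrix
`γ̂(h) = n⁻¹ ∑ (x_{t+h} - x̄)(x_t - x̄)'`, the sum being over all `t` for which both `t` and `t + h`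
lie in `{1, …, n}`. For `h ≥ 0` this means `1 ≤ t ≤ n - h`; moreover `γ̂(-h) = γ̂(h)'`, and
`γ̂(h) = 0` if `|h| ≥ n`. -/
def sampleAutocov (x : ℤ → (Fin m → ℝ)) (n : ℕ) (h : ℤ) : Matrix (Fin m) (Fin m) ℝ :=
  Matrix.of fun j k =>
    (n : ℝ)⁻¹ * ∑ t ∈ (Finset.Icc (1 : ℤ) n).filter (fun t => t + h ∈ Finset.Icc (1 : ℤ) n),
      (x (t + h) j - sampleMean x n j) * (x t k - sampleMean x n k)

/-- The periodogram matrix `I(w) = (2π)⁻¹ ∑_h e^{-iwh} γ̂(h)`; the terms with `|h| ≥ n` vanish. -/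
def periodogram (x : ℤ → (Fin m → ℝ)) (n : ℕ) (w : ℝ) : Matrix (Fin m) (Fin m) ℂ :=
  Matrix.of fun j k =>
    (2 * (Real.pi : ℂ))⁻¹ *
      ∑ h ∈ Finset.Ioo (-(n : ℤ)) n,
        Complex.exp (-Complex.I * (w : ℂ) * (h : ℂ)) * (sampleAutocov x n h j k : ℂ)

/-- The Fourier frequency `w_s = 2πs/n`. -/
def fourierFreq (n : ℕ) (s : ℤ) : ℝ := 2 * Real.pi * s / n

/-- The number of regression points `M = [δn]`. -/
def bandwidth (δ : ℝ) (n : ℕ) : ℕ := ⌊δ * n⌋₊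

/-- The indices of the Fourier frequencies used in the regression at the boundary frequency `θ`:
`1 ≤ s ≤ M` if `θ = 0`, and `[n/2] - M + 1 ≤ s ≤ [n/2]` if `θ = π`. -/
def regIndices (θ δ : ℝ) (n : ℕ) : Finset ℤ :=
  if θ = 0 then Finset.Icc 1 (bandwidth δ n : ℤ)
  else Finset.Icc ((n : ℤ) / 2 - bandwidth δ n + 1) ((n : ℤ) / 2)

/-- The design matrix: a column of ones and a column with entries `(θ - w_s)²`. -/
def designMatrix (θ δ : ℝ) (n : ℕ) : Matrix (regIndices θ δ n) (Fin 2) ℝ :=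
  Matrix.of fun s => ![1, (θ - fourierFreq n s) ^ 2]

/-- The response vector, with entries `Re I_{jk}(w_s)`. -/
def response (x : ℤ → (Fin m → ℝ)) (θ δ : ℝ) (j k : Fin m) (n : ℕ) : regIndices θ δ n → ℝ :=
  fun s => (periodogram x n (fourierFreq n s) j k).re

/-- The ordinary least squares boundary estimator of `f_{jk}(θ)`: the intercept, i.e. the first
component of `(X'X)⁻¹ X'Y`. -/
def olsEstimator (x : ℤ → (Fin m → ℝ)) (θ δ : ℝ) (j k : Fin m) (n : ℕ) : ℝ :=
  ((((designMatrix θ δ n)ᵀ * designMatrix θ δ n)⁻¹ * (designMatrix θ δ n)ᵀ) *ᵥ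
    response x θ δ j k n) 0

/-- `c_q = M⁻¹ ∑_s (θ - w_s)^q`, used for `q = 2, 4`. -/
def cMoment (θ δ : ℝ) (n q : ℕ) : ℝ :=
  (bandwidth δ n : ℝ)⁻¹ * ∑ s ∈ regIndices θ δ n, (θ - fourierFreq n s) ^ q

/-- `F_q = M⁻¹ ∑_s (θ - w_s)^q (f_{jk}(w_s)² + f_{kj}(w_s)² + 2 f_{jj}(w_s) f_{kk}(w_s))`, used for
`q = 0, 2, 4`. -/
def FMoment (f : ℝ → Matrix (Fin m) (Fin m) ℂ) (θ δ : ℝ) (j k : Fin m) (n q : ℕ) : ℂ :=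
  (bandwidth δ n : ℂ)⁻¹ * ∑ s ∈ regIndices θ δ n, ((θ - fourierFreq n s : ℝ) : ℂ) ^ q *
    (f (fourierFreq n s) j k ^ 2 + f (fourierFreq n s) k j ^ 2
      + 2 * f (fourierFreq n s) j j * f (fourierFreq n s) k k)

/-- `G_q = M⁻¹ ∑_s (θ - w_s)^q Re f_{jk}(w_s)`, used for `q = 0, 2`. -/
def GMoment (f : ℝ → Matrix (Fin m) (Fin m) ℂ) (θ δ : ℝ) (j k : Fin m) (n q : ℕ) : ℝ :=
  (bandwidth δ n : ℝ)⁻¹ * ∑ s ∈ regIndices θ δ n,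
    (θ - fourierFreq n s) ^ q * (f (fourierFreq n s) j k).re

end BoundarySpec

end

/-! Cramer's rule writes the intercept as `∑ a_s Re I_jk(w_s)` with the deterministic weights `a_s =
(c₄ - c₂ (θ - w_s)²) / (M (c₄ - c₂²))` (`olsEstimator_eq_sum`). Everything follows from the first
two moments of the ordinates and from `a_s = O(1/n)` uniformly in `s`. The latter needs `c₄ - c₂²`
to stay away from zero (`le_cMoment_sub`).

At a nonzero Fourier frequency the periodogram does not see the centring constants, so `Re
I_jk(w_s)` is a quadratic form in centred Gaussian variables. Isserlis' formula turns the covariance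
of two ordinates into products of covariances of discrete Fourier transforms
(`sum_cos_mul_cos_eq_dftCov`). Up to `O(1/n)`, these are `f` when the frequencies agree modulo `2π`
and zero otherwise, provided `∑ |h| |γ(h)| < ∞` (`norm_dftCov_sub_le`). That summability comes from
the smoothness of `f` through three integrations by parts.

Hence an ordinate has mean `Re f_jk(w_s) + O(1/n)`. Two distinct ordinates have covariance `O(n⁻²)`,
and the variance is `(f_jk² + f_kj² + 2 f_jj f_kk)/4 + O(1/n)`, except at `w_s = π`, where the
transform is real and only an `O(1)` error is claimed. With weights `O(1/n)` the bias error is `n ·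
n⁻¹ · n⁻¹`. In the variance the `M²` off-diagonal pairs, the diagonal and the one exceptional index
all cost at most `O(n⁻²)`, as does replacing `1/M` by `1/(δn)`; so the `o(1/n)` is in fact `O(n⁻²)`.
The sums `F` and `G` are kept as they are, so `f` is never expanded around `θ`. -/

/-! ### Fourth moment of a Gaussian variable, from its moment generating function. -/

theorem iteratedDeriv_four_exp_mul_sq (v : ℝ) :
    iteratedDeriv 4 (fun t : ℝ => Real.exp (v * t ^ 2 / 2)) 0 = 3 * v ^ 2 := by
  -- Differentiation preserves the form polynomial times `exp (v t² / 2)`, so four derivatives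
  -- amount to four updates `p ↦ p' + v t p` starting from `p = 1`.
  have key : ∀ (p p' : ℝ → ℝ), (∀ t, HasDerivAt p (p' t) t) →
      deriv (fun t : ℝ => p t * Real.exp (v * t ^ 2 / 2))
        = fun t => (p' t + v * t * p t) * Real.exp (v * t ^ 2 / 2) := by
    intro p p' hp
    funext t
    have h1 : HasDerivAt (fun t : ℝ => v * t ^ 2 / 2) (v * t) t := by
      have : HasDerivAt (fun t : ℝ => v * t ^ 2 / 2) _ t :=
        (((hasDerivAt_id' t).fun_pow 2).const_mul v).div_const 2
      exact this.congr_deriv (by simp; ring)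
    rw [((hp t).fun_mul h1.exp).deriv]
    ring
  have h0 : (fun t : ℝ => Real.exp (v * t ^ 2 / 2))
      = fun t => (fun _ : ℝ => (1 : ℝ)) t * Real.exp (v * t ^ 2 / 2) := by simp
  rw [iteratedDeriv_succ', iteratedDeriv_succ', iteratedDeriv_succ', iteratedDeriv_succ',
    iteratedDeriv_zero, h0, key _ (fun _ => 0) (fun t => hasDerivAt_const t 1),
    key (fun t => 0 + v * t * 1) (fun _ => v) (fun t => ?_),
    key (fun t => v + v * t * (0 + v * t * 1)) (fun t => 2 * v ^ 2 * t) (fun t => ?_),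
    key (fun t => 2 * v ^ 2 * t + v * t * (v + v * t * (0 + v * t * 1)))
      (fun t => 3 * v ^ 2 + 3 * v ^ 3 * t ^ 2) (fun t => ?_)]
  · simp
  · have : HasDerivAt (fun t : ℝ => 3 * v ^ 2 * t + v ^ 3 * t ^ 3) _ t :=
      ((hasDerivAt_id' t).const_mul (3 * v ^ 2)).fun_add
        (((hasDerivAt_id' t).fun_pow 3).const_mul (v ^ 3))
    refine (this.congr_deriv (by simp; ring)).congr_of_eventuallyEq
      (Eventually.of_forall fun t => ?_)
    ring
  · have : HasDerivAt (fun t : ℝ => v + v ^ 2 * t ^ 2) _ t :=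
      (((hasDerivAt_id' t).fun_pow 2).const_mul (v ^ 2)).const_add v
    refine (this.congr_deriv (by simp; ring)).congr_of_eventuallyEq
      (Eventually.of_forall fun t => ?_)
    ring
  · have : HasDerivAt (fun t : ℝ => v * t) _ t := (hasDerivAt_id' t).const_mul v
    refine (this.congr_deriv (by simp)).congr_of_eventuallyEq
      (Eventually.of_forall fun t => ?_)
    ring

theorem integral_pow_four_gaussianReal (v : NNReal) :
    ∫ x, x ^ 4 ∂(gaussianReal 0 v) = 3 * (v : ℝ) ^ 2 := by
  have h := iteratedDeriv_mgf_zero (X := id) (μ := gaussianReal 0 v)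
    (by rw [integrableExpSet_id_gaussianReal]; simp) 4
  rw [mgf_id_gaussianReal] at h
  simp only [zero_mul, zero_add, iteratedDeriv_four_exp_mul_sq] at h
  simpa using h.symm

theorem HasGaussianLaw.integral_sub_mean_pow_four {Ω : Type*} [MeasurableSpace Ω] {P : Measure Ω}
    {S : Ω → ℝ} (hS : HasGaussianLaw S P) :
    ∫ ω, (S ω - ∫ ω', S ω' ∂P) ^ 4 ∂P = 3 * (variance S P) ^ 2 := by
  have hm := hS.aemeasurable
  have hlaw : P.map (fun ω => S ω - ∫ ω', S ω' ∂P) = gaussianReal 0 (variance S P).toNNReal := by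
    have := gaussianReal_sub_const ⟨hm, hS.map_eq_gaussianReal⟩ (∫ ω', S ω' ∂P)
    rw [sub_self] at this
    exact this.map_eq
  have : ∫ ω, (S ω - ∫ ω', S ω' ∂P) ^ 4 ∂P
      = ∫ x, x ^ 4 ∂(P.map (fun ω => S ω - ∫ ω', S ω' ∂P)) := by
    rw [integral_map (hm.sub_const _) (by fun_prop)]
  rw [this, hlaw, integral_pow_four_gaussianReal, Real.coe_toNNReal _ (variance_nonneg _ _)]

/-! ### Isserlis' formula by polarization. -/

section Isserlis

variable {Ω T : Type*} [MeasurableSpace Ω] {P : Measure Ω} {Y : T → Ω → ℝ}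

/-- The process `Y` with its mean function subtracted. -/
noncomputable def centeredProcess (Y : T → Ω → ℝ) (P : Measure Ω) (t : T) (ω : Ω) : ℝ :=
  Y t ω - ∫ ω', Y t ω' ∂P

theorem IsGaussianProcess.memLp_centered (hY : IsGaussianProcess Y P) (t : T) {p : ENNReal}
    (hp : p ≠ ⊤) : MemLp (centeredProcess Y P t) p P := by
  have := hY.isProbabilityMeasure
  exact ((hY.hasGaussianLaw_eval t).memLp hp).sub (memLp_const _)

theorem IsGaussianProcess.memLp_centered_mul (hY : IsGaussianProcess Y P) (a b : T)
    {p : ENNReal} (hp : p ≠ ⊤) :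
    MemLp (fun ω => centeredProcess Y P a ω * centeredProcess Y P b ω) p P := by
  have hq : 2 * p ≠ ⊤ := ENNReal.mul_ne_top (by simp) hp
  have : ENNReal.HolderTriple (2 * p) (2 * p) p := ⟨by
    rw [ENNReal.mul_inv (by simp) (by simp), ← two_mul, ← mul_assoc,
      ENNReal.mul_inv_cancel (by simp) (by simp), one_mul]⟩
  exact (IsGaussianProcess.memLp_centered hY b hq).mul (IsGaussianProcess.memLp_centered hY a hq)

theorem integral_centered_mul (s t : T) :
    ∫ ω, centeredProcess Y P s ω * centeredProcess Y P t ω ∂P = covariance (Y s) (Y t) P := rfl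

theorem IsGaussianProcess.integral_linear_comb_pow_four (hY : IsGaussianProcess Y P)
    (p : Fin 4 → T) (c : Fin 4 → ℝ) :
    ∫ ω, (∑ i, c i * centeredProcess Y P (p i) ω) ^ 4 ∂P
      = 3 * (∑ i, ∑ j, c i * c j * covariance (Y (p i)) (Y (p j)) P) ^ 2 := by
  have := hY.isProbabilityMeasure
  have hg : HasGaussianLaw (fun ω => ∑ i, c i * Y (p i) ω) P := by
    have := ((hY.comp_right p).smul c).hasGaussianLaw_fun_sum (I := Finset.univ)
    simpa using this
  have h := HasGaussianLaw.integral_sub_mean_pow_four hg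
  rw [integral_finsetSum _ (fun i _ => ((hY.hasGaussianLaw_eval (p i)).integrable.const_mul _)),
    variance_fun_sum (fun i => ((hY.hasGaussianLaw_eval (p i)).memLp_two.const_mul _))] at h
  simp only [covariance_const_mul_left, covariance_const_mul_right, integral_const_mul,
    ← Finset.sum_sub_distrib, ← mul_sub] at h
  simpa only [centeredProcess, mul_assoc, mul_left_comm (c _) (c _)] using h

/-- Fourth powers over the eight sign choices, each weighted by the product of its signs: only the
monomial `ABCD` survives, with coefficient `8 · 4!`. This reduces mixed moments to fourth moments of
linear combinations, which are Gaussian. -/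
theorem polarization_four (A B C D : ℝ) :
    192 * (A * B * (C * D)) = (A + B + C + D) ^ 4 - (A + B + C - D) ^ 4 - (A + B - C + D) ^ 4
      + (A + B - C - D) ^ 4 - (A - B + C + D) ^ 4 + (A - B + C - D) ^ 4 + (A - B - C + D) ^ 4
      - (A - B - C - D) ^ 4 := by ring

/-- Isserlis' formula for the fourth mixed moment of a Gaussian process. -/
theorem IsGaussianProcess.isserlis (hY : IsGaussianProcess Y P) (a b c d : T) :
    ∫ ω, (centeredProcess Y P a ω * centeredProcess Y P b ω)
        * (centeredProcess Y P c ω * centeredProcess Y P d ω) ∂P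
      = covariance (Y a) (Y b) P * covariance (Y c) (Y d) P
        + covariance (Y a) (Y c) P * covariance (Y b) (Y d) P
        + covariance (Y a) (Y d) P * covariance (Y b) (Y c) P := by
  have := hY.isProbabilityMeasure
  have hint : ∀ e : Fin 4 → ℝ,
      Integrable (fun ω => (∑ i, e i * centeredProcess Y P (![a, b, c, d] i) ω) ^ 4) P := by
    intro e
    have h4 : MemLp (fun ω => ∑ i, e i * centeredProcess Y P (![a, b, c, d] i) ω) (4 : ℕ) P :=
      memLp_finsetSum _ (fun i _ =>
        (IsGaussianProcess.memLp_centered hY _ (by simp)).const_mul _)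
    simpa using (h4.integrable_norm_pow (by norm_num)).congr
      (Eventually.of_forall fun ω => by simp [Even.pow_abs (by decide : Even 4)])
  have hval := fun e : Fin 4 → ℝ =>
    IsGaussianProcess.integral_linear_comb_pow_four hY ![a, b, c, d] e
  have hfun : ∀ ω, 192 * ((centeredProcess Y P a ω * centeredProcess Y P b ω)
      * (centeredProcess Y P c ω * centeredProcess Y P d ω))
      = (∑ i, (![1, 1, 1, 1] : Fin 4 → ℝ) i * centeredProcess Y P (![a, b, c, d] i) ω) ^ 4
      - (∑ i, (![1, 1, 1, -1] : Fin 4 → ℝ) i * centeredProcess Y P (![a, b, c, d] i) ω) ^ 4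
      - (∑ i, (![1, 1, -1, 1] : Fin 4 → ℝ) i * centeredProcess Y P (![a, b, c, d] i) ω) ^ 4
      + (∑ i, (![1, 1, -1, -1] : Fin 4 → ℝ) i * centeredProcess Y P (![a, b, c, d] i) ω) ^ 4
      - (∑ i, (![1, -1, 1, 1] : Fin 4 → ℝ) i * centeredProcess Y P (![a, b, c, d] i) ω) ^ 4
      + (∑ i, (![1, -1, 1, -1] : Fin 4 → ℝ) i * centeredProcess Y P (![a, b, c, d] i) ω) ^ 4
      + (∑ i, (![1, -1, -1, 1] : Fin 4 → ℝ) i * centeredProcess Y P (![a, b, c, d] i) ω) ^ 4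
      - (∑ i, (![1, -1, -1, -1] : Fin 4 → ℝ) i * centeredProcess Y P (![a, b, c, d] i) ω) ^ 4 := by
    intro ω
    rw [polarization_four]
    simp only [Fin.sum_univ_four]
    simp [sub_eq_add_neg]
  have h192 : (192 : ℝ) * ∫ ω, (centeredProcess Y P a ω * centeredProcess Y P b ω)
        * (centeredProcess Y P c ω * centeredProcess Y P d ω) ∂P
      = 192 * (covariance (Y a) (Y b) P * covariance (Y c) (Y d) P
        + covariance (Y a) (Y c) P * covariance (Y b) (Y d) P
        + covariance (Y a) (Y d) P * covariance (Y b) (Y c) P) := by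
    rw [← integral_const_mul]
    simp_rw [hfun]
    rw [integral_sub, integral_add, integral_add, integral_sub, integral_add, integral_sub,
      integral_sub]
    · simp only [hval]
      simp only [Fin.sum_univ_four]
      simp [covariance_comm (Y b) (Y a), covariance_comm (Y c) (Y a), covariance_comm (Y d) (Y a),
        covariance_comm (Y c) (Y b), covariance_comm (Y d) (Y b), covariance_comm (Y d) (Y c)]
      ring
    all_goals
      repeat' first | exact hint _ | apply Integrable.sub | apply Integrable.add
  linarith

/-- Subtracting the product of the means removes one of the three pairings in Isserlis' formula. -/
theorem IsGaussianProcess.covariance_centered_mul (hY : IsGaussianProcess Y P) (a b c d : T) :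
    covariance (fun ω => centeredProcess Y P a ω * centeredProcess Y P b ω)
        (fun ω => centeredProcess Y P c ω * centeredProcess Y P d ω) P
      = covariance (Y a) (Y c) P * covariance (Y b) (Y d) P
        + covariance (Y a) (Y d) P * covariance (Y b) (Y c) P := by
  have := hY.isProbabilityMeasure
  rw [covariance_eq_sub (IsGaussianProcess.memLp_centered_mul hY a b (by simp))
    (IsGaussianProcess.memLp_centered_mul hY c d (by simp)), integral_centered_mul,
    integral_centered_mul]
  have := IsGaussianProcess.isserlis hY a b c d
  simp only [Pi.mul_apply]
  rw [this]
  ring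

end Isserlis

/-! ### Decay of Fourier coefficients of a smooth function. -/

section FourierDecay

open Complex in
theorem integral_exp_int_period (k : ℤ) :
    ∫ w in (0 : ℝ)..(2 * Real.pi), cexp (I * (w : ℂ) * (k : ℂ))
      = if k = 0 then 2 * (Real.pi : ℂ) else 0 := by
  split_ifs with hk
  · subst hk; simp
  · have hc : I * (k : ℂ) ≠ 0 := mul_ne_zero I_ne_zero (by exact_mod_cast hk)
    have h := integral_exp_mul_complex (a := 0) (b := 2 * Real.pi) hc
    have h1 : cexp (I * k * ((2 * Real.pi : ℝ) : ℂ)) = 1 := by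
      rw [← Complex.exp_int_mul_two_pi_mul_I k]; push_cast; ring_nf
    rw [h1] at h
    simp only [mul_right_comm I _ (k : ℂ)]
    rw [h]; simp

open Complex in
/-- The coefficients of an absolutely convergent trigonometric series are its Fourier
coefficients. -/
theorem integral_exp_mul_tsum {γ : ℤ → ℂ} (hγ : Summable fun h => ‖γ h‖) (k : ℤ) :
    ∫ w in (0 : ℝ)..(2 * Real.pi), cexp (I * (w : ℂ) * (k : ℂ))
        * ∑' h : ℤ, cexp (-I * (w : ℂ) * (h : ℂ)) * γ h = 2 * (Real.pi : ℂ) * γ k := by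
  have hn : ∀ (w : ℝ) (h : ℤ), ‖cexp (I * (w : ℂ) * (k : ℂ))
      * (cexp (-I * (w : ℂ) * (h : ℂ)) * γ h)‖ = ‖γ h‖ := by
    intro w h
    simp [Complex.norm_exp]
  have hs := intervalIntegral.hasSum_integral_of_dominated_convergence (μ := volume)
    (a := (0 : ℝ)) (b := 2 * Real.pi)
    (F := fun (h : ℤ) (w : ℝ) => cexp (I * (w : ℂ) * (k : ℂ))
      * (cexp (-I * (w : ℂ) * (h : ℂ)) * γ h))
    (f := fun w : ℝ => cexp (I * (w : ℂ) * (k : ℂ))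
        * ∑' h : ℤ, cexp (-I * (w : ℂ) * (h : ℂ)) * γ h)
    (fun h _ => ‖γ h‖) (fun h => by fun_prop)
    (fun h => Eventually.of_forall fun w _ => (hn w h).le)
    (Eventually.of_forall fun w _ => hγ) (by simp)
    (Eventually.of_forall fun w _ => by
      apply HasSum.mul_left
      apply Summable.hasSum
      apply Summable.of_norm
      simpa [Complex.norm_exp] using hγ)
  refine hs.unique ?_
  have hval : ∀ h : ℤ, ∫ w in (0 : ℝ)..(2 * Real.pi), cexp (I * (w : ℂ) * (k : ℂ))
      * (cexp (-I * (w : ℂ) * (h : ℂ)) * γ h) = if h = k then 2 * (Real.pi : ℂ) * γ k else 0 := by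
    intro h
    have : ∀ w : ℝ, cexp (I * (w : ℂ) * (k : ℂ)) * (cexp (-I * (w : ℂ) * (h : ℂ)) * γ h)
        = cexp (I * (w : ℂ) * ((k - h : ℤ) : ℂ)) * γ h := by
      intro w
      rw [← mul_assoc, ← Complex.exp_add]
      push_cast; ring_nf
    simp_rw [this]
    rw [intervalIntegral.integral_mul_const, integral_exp_int_period]
    by_cases hk : h = k
    · simp [hk]
    · rw [if_neg hk, if_neg (fun h0 => hk (by linarith)), zero_mul]
  simp_rw [hval]
  exact hasSum_ite_eq k _

-- Integration by parts; periodicity kills the boundary terms, and the factor `ik` has norm `|k|`.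
open Complex in
theorem norm_integral_exp_mul_deriv {g : ℝ → ℂ} (hg : ContDiff ℝ 1 g)
    (hper : Function.Periodic g (2 * Real.pi)) (k : ℤ) :
    ‖∫ w in (0 : ℝ)..(2 * Real.pi), cexp (I * (w : ℂ) * (k : ℂ)) * deriv g w‖
      = |(k : ℝ)| * ‖∫ w in (0 : ℝ)..(2 * Real.pi), cexp (I * (w : ℂ) * (k : ℂ)) * g w‖ := by
  have he : ∀ w : ℝ, HasDerivAt (fun w : ℝ => cexp (I * (w : ℂ) * (k : ℂ)))
      (I * k * cexp (I * (w : ℂ) * (k : ℂ))) w := by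
    intro w
    have h1 : HasDerivAt (fun w : ℝ => I * (w : ℂ) * (k : ℂ)) (I * k) w := by
      simpa using ((hasDerivAt_id w).ofReal_comp.const_mul I).mul_const (k : ℂ)
    simpa [mul_comm] using h1.cexp
  have hd : ∀ w : ℝ, HasDerivAt g (deriv g w) w := fun w =>
    (hg.differentiable (by norm_num) w).hasDerivAt
  rw [intervalIntegral.integral_mul_deriv_eq_deriv_mul (fun w _ => he w) (fun w _ => hd w)
    (Continuous.intervalIntegrable (by fun_prop) _ _)
    ((hg.continuous_deriv le_rfl).intervalIntegrable _ _)]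
  have h1 : cexp (I * ((2 * Real.pi : ℝ) : ℂ) * k) = 1 := by
    rw [← Complex.exp_int_mul_two_pi_mul_I k]; push_cast; ring_nf
  have h2 : g (2 * Real.pi) = g 0 := by simpa using hper 0
  rw [h1, h2]
  simp only [ofReal_zero, mul_zero, zero_mul, Complex.exp_zero, one_mul, sub_self, zero_sub,
    norm_neg, mul_assoc]
  rw [intervalIntegral.integral_const_mul, intervalIntegral.integral_const_mul]
  simp

theorem Function.Periodic.deriv_of_real {g : ℝ → ℂ} {c : ℝ} (h : Function.Periodic g c) :
    Function.Periodic (deriv g) c := by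
  intro x
  rw [← deriv_comp_add_const]
  congr 1
  funext y
  exact h y

open Complex in
/-- The coefficients of an absolutely convergent trigonometric series with a three times
continuously differentiable sum are `O(|h|⁻³)`, so their first absolute moment is finite. -/
theorem summable_abs_mul_norm_of_contDiff {γ : ℤ → ℂ} (hγ : Summable fun h => ‖γ h‖) {g : ℝ → ℂ}
    (hg : ∀ w : ℝ, g w = ∑' h : ℤ, cexp (-I * (w : ℂ) * (h : ℂ)) * γ h) (hd : ContDiff ℝ 3 g) :
    Summable fun h : ℤ => |(h : ℝ)| * ‖γ h‖ := by
  have hper : Function.Periodic g (2 * Real.pi) := by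
    intro w
    rw [hg, hg]
    refine tsum_congr fun h => ?_
    congr 1
    have : -I * ((w + 2 * Real.pi : ℝ) : ℂ) * (h : ℂ)
        = -I * (w : ℂ) * h + ((-h : ℤ) : ℂ) * (2 * Real.pi * I) := by push_cast; ring
    rw [this, Complex.exp_add, Complex.exp_int_mul_two_pi_mul_I, mul_one]
  have hd1 : ContDiff ℝ 2 (deriv g) := by
    rw [show (3 : WithTop ℕ∞) = 2 + 1 by norm_num, contDiff_succ_iff_deriv] at hd
    exact hd.2.2
  have hd2 : ContDiff ℝ 1 (deriv (deriv g)) := by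
    have h := hd1
    rw [show (2 : WithTop ℕ∞) = 1 + 1 by norm_num, contDiff_succ_iff_deriv] at h
    exact h.2.2
  have hd3 : Continuous (deriv (deriv (deriv g))) := hd2.continuous_deriv le_rfl
  obtain ⟨B, hB⟩ := (isCompact_Icc (a := (0 : ℝ)) (b := 2 * Real.pi)).exists_bound_of_continuousOn
    hd3.continuousOn
  have hpi := Real.pi_pos
  -- Three integrations by parts identify `2π |k|³ ‖γ k‖` with the norm of the `k`-th Fourier
  -- integral of `g'''`, which is at most `2πB`.
  have hmain : ∀ k : ℤ, |(k : ℝ)| ^ 3 * ‖γ k‖ ≤ B := by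
    intro k
    have e1 := norm_integral_exp_mul_deriv (hd.of_le (by norm_num)) hper k
    have e2 := norm_integral_exp_mul_deriv (hd1.of_le (by norm_num)) hper.deriv_of_real k
    have e3 := norm_integral_exp_mul_deriv hd2 hper.deriv_of_real.deriv_of_real k
    have e0 := integral_exp_mul_tsum hγ k
    simp_rw [← hg] at e0
    rw [e2, e1, e0] at e3
    have hb : ‖∫ w in (0 : ℝ)..(2 * Real.pi), cexp (I * (w : ℂ) * (k : ℂ))
        * deriv (deriv (deriv g)) w‖ ≤ B * |2 * Real.pi - 0| := by
      apply intervalIntegral.norm_integral_le_of_norm_le_const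
      intro w hw
      rw [Set.uIoc_of_le (by positivity)] at hw
      simpa [Complex.norm_exp] using hB w ⟨hw.1.le, hw.2⟩
    rw [e3] at hb
    rw [sub_zero, abs_of_pos (by positivity : 0 < 2 * Real.pi)] at hb
    have : ‖2 * (Real.pi : ℂ) * γ k‖ = 2 * Real.pi * ‖γ k‖ := by
      simp [abs_of_pos hpi]
    rw [this] at hb
    have h2 : (2 * Real.pi) * (|(k : ℝ)| ^ 3 * ‖γ k‖) ≤ (2 * Real.pi) * B := by linarith
    exact le_of_mul_le_mul_left h2 (by positivity)
  have hs : Summable fun k : ℤ => B * (1 / (k : ℝ) ^ 2) :=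
    (Real.summable_one_div_int_pow.mpr (by norm_num)).mul_left B
  refine Summable.of_nonneg_of_le (fun k => by positivity) (fun k => ?_) hs
  rcases eq_or_ne k 0 with rfl | hk
  · simp
  · have hk2 : 0 < |(k : ℝ)| := abs_pos.mpr (by exact_mod_cast hk)
    rw [mul_one_div, le_div_iff₀ (by positivity), ← sq_abs]
    calc _ = |(k : ℝ)| ^ 3 * ‖γ k‖ := by ring
      _ ≤ B := hmain k

end FourierDecay

namespace BoundarySpec

/-! ### Covariances of discrete Fourier transforms. -/

section DiscreteFourier

open Complex

theorem sum_Icc_int_eq_sum_range {M : Type*} [AddCommMonoid M] (n : ℕ) (F : ℤ → M) :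
    ∑ u ∈ Finset.Icc (1 : ℤ) n, F u = ∑ i ∈ Finset.range n, F (i + 1) := by
  symm
  refine Finset.sum_bij (fun i _ => (i : ℤ) + 1) ?_ ?_ ?_ ?_
  · intro i hi; simp at hi ⊢; omega
  · intro a _ b _ h; simpa using h
  · intro b hb
    simp only [Finset.mem_Icc] at hb
    exact ⟨(b - 1).toNat, by simp; omega, by omega⟩
  · intro i _; rfl

theorem exp_fourierFreq_eq_one_iff {n : ℕ} (hn : n ≠ 0) (d : ℤ) :
    cexp (I * (fourierFreq n d : ℂ)) = 1 ↔ (n : ℤ) ∣ d := by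
  have hn' : (n : ℂ) ≠ 0 := by exact_mod_cast hn
  have hpi : (Real.pi : ℂ) ≠ 0 := by exact_mod_cast Real.pi_ne_zero
  rw [Complex.exp_eq_one_iff]
  constructor
  · rintro ⟨k, hk⟩
    refine ⟨k, ?_⟩
    have : (d : ℂ) = n * k := by
      unfold fourierFreq at hk
      push_cast at hk
      field_simp at hk
      exact hk
    exact_mod_cast this
  · rintro ⟨k, rfl⟩
    refine ⟨k, ?_⟩
    unfold fourierFreq
    push_cast
    field_simp

theorem sum_exp_fourierFreq {n : ℕ} (hn : n ≠ 0) (d : ℤ) :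
    ∑ u ∈ Finset.Icc (1 : ℤ) n, cexp (I * (fourierFreq n d : ℂ) * (u : ℂ))
      = if (n : ℤ) ∣ d then (n : ℂ) else 0 := by
  rw [sum_Icc_int_eq_sum_range]
  set z := cexp (I * (fourierFreq n d : ℂ)) with hz
  have hpow : ∀ i : ℕ, cexp (I * (fourierFreq n d : ℂ) * (((i : ℤ) + 1 : ℤ) : ℂ)) = z * z ^ i := by
    intro i
    rw [hz, ← Complex.exp_nat_mul, ← Complex.exp_add]
    push_cast; ring_nf
  simp_rw [hpow]
  rw [← Finset.mul_sum]
  have hiff := exp_fourierFreq_eq_one_iff hn d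
  rw [← hz] at hiff
  split_ifs with h
  · rw [hiff.mpr h]; simp
  · have h1 : z ≠ 1 := fun h1 => h (hiff.mp h1)
    have hzn : z ^ n = 1 := by
      rw [hz, ← Complex.exp_nat_mul, ← Complex.exp_int_mul_two_pi_mul_I d]
      unfold fourierFreq
      have hn' : (n : ℂ) ≠ 0 := by exact_mod_cast hn
      push_cast
      congr 1
      field_simp
    rw [geom_sum_eq h1, hzn]
    simp

/-- The points pushed out of `{1, …, n}` by a shift lie in a window of length `|h|` at one end. -/
theorem card_filter_add_notMem_Icc_le (n : ℕ) (h : ℤ) :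
    (((Finset.Icc (1 : ℤ) n).filter (fun u => u + h ∉ Finset.Icc (1 : ℤ) n)).card : ℝ) ≤ |(h : ℝ)| := by
  have hc : (((Finset.Icc (1 : ℤ) n).filter
      (fun u => u + h ∉ Finset.Icc (1 : ℤ) n)).card : ℤ) ≤ |h| := by
    rcases le_or_gt 0 h with h0 | h0
    · have hs : (Finset.Icc (1 : ℤ) n).filter (fun u => u + h ∉ Finset.Icc (1 : ℤ) n)
          ⊆ Finset.Ioc ((n : ℤ) - h) n := by
        intro u hu; simp at hu ⊢; omega
      have := Finset.card_le_card hs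
      rw [Int.card_Ioc] at this
      rw [abs_of_nonneg h0]; omega
    · have hs : (Finset.Icc (1 : ℤ) n).filter (fun u => u + h ∉ Finset.Icc (1 : ℤ) n)
          ⊆ Finset.Ico 1 (1 - h) := by
        intro u hu; simp at hu ⊢; omega
      have := Finset.card_le_card hs
      rw [Int.card_Ico] at this
      rw [abs_of_neg h0]; omega
  exact_mod_cast hc

/-- The cross covariance `E[J_a(w_s) conj(J_b(w_{s'}))]` of the discrete Fourier transforms
`J_a(w) = (2πn)^{-1/2} ∑_t e^{-iwt} Z_{t,a}` when `Cov[Z_{t,a}, Z_{u,b}] = γ(t - u)`. -/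
noncomputable def dftCov (γ : ℤ → ℂ) (n : ℕ) (s s' : ℤ) : ℂ :=
  (2 * (Real.pi : ℂ) * n)⁻¹ * ∑ t ∈ Finset.Icc (1 : ℤ) n, ∑ u ∈ Finset.Icc (1 : ℤ) n,
    cexp (-I * (fourierFreq n s : ℂ) * (t : ℂ)) * cexp (I * (fourierFreq n s' : ℂ) * (u : ℂ))
      * γ (t - u)

/-- The substitution `t = u + h`, which lets a finite sum over `t` be compared term by term with the
series over all lags `h`. -/
theorem tsum_shift_ite_mem {S : Finset ℤ} (φ : ℤ → ℂ) (u : ℤ) :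
    HasSum (fun h => if u + h ∈ S then φ (u + h) else 0) (∑ t ∈ S, φ t) := by
  have h1 : HasSum (fun t => if t ∈ S then φ t else 0) (∑ t ∈ S, φ t) := by
    have : HasSum (fun t => if t ∈ S then φ t else 0) (∑ t ∈ S, if t ∈ S then φ t else 0) :=
      hasSum_sum_of_ne_finset_zero fun b hb => if_neg hb
    rwa [Finset.sum_congr rfl fun t ht => if_pos ht] at this
  have h2 := (Equiv.hasSum_iff (Equiv.addLeft u)).mpr h1
  exact h2

/-- For fixed `u`, put `t = u + h` and complete the sum to all lags: this gives `e u` times the full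
series, and `∑ e u` is `n` or `0` by orthogonality. The terms added are those with `u + h` outside
the sample; a lag `h` is missing for at most `|h|` values of `u`, so the total error before
normalization is at most `∑ |h| ‖γ h‖`. -/
theorem norm_dftCov_sub_le {γ : ℤ → ℂ} (hγ : Summable fun h => ‖γ h‖)
    (hγ' : Summable fun h : ℤ => |(h : ℝ)| * ‖γ h‖) {n : ℕ} (hn : n ≠ 0) (s s' : ℤ) :
    ‖dftCov γ n s s' - if (n : ℤ) ∣ s' - s then
        (2 * (Real.pi : ℂ))⁻¹ * ∑' h : ℤ, cexp (-I * (fourierFreq n s : ℂ) * (h : ℂ)) * γ h else 0‖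
      ≤ (2 * Real.pi)⁻¹ * (∑' h : ℤ, |(h : ℝ)| * ‖γ h‖) * (n : ℝ)⁻¹ := by
  have hn' : (n : ℂ) ≠ 0 := by exact_mod_cast hn
  have hpi : (Real.pi : ℂ) ≠ 0 := by exact_mod_cast Real.pi_ne_zero
  set S := Finset.Icc (1 : ℤ) n with hS
  set fs := ∑' h : ℤ, cexp (-I * (fourierFreq n s : ℂ) * (h : ℂ)) * γ h with hfs
  set e : ℤ → ℂ := fun u => cexp (I * (fourierFreq n (s' - s) : ℂ) * (u : ℂ)) with he
  have hne : ∀ u, ‖e u‖ = 1 := by intro u; simp [he, Complex.norm_exp]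
  have hsf : HasSum (fun h : ℤ => cexp (-I * (fourierFreq n s : ℂ) * (h : ℂ)) * γ h) fs := by
    apply Summable.hasSum
    apply Summable.of_norm
    simpa [Complex.norm_exp] using hγ
  have hrow : ∀ u : ℤ, HasSum (fun h : ℤ => if u + h ∈ S then
      e u * (cexp (-I * (fourierFreq n s : ℂ) * (h : ℂ)) * γ h) else 0)
      (∑ t ∈ S, cexp (-I * (fourierFreq n s : ℂ) * (t : ℂ))
        * cexp (I * (fourierFreq n s' : ℂ) * (u : ℂ)) * γ (t - u)) := by
    intro u
    convert tsum_shift_ite_mem (S := S) (fun t => cexp (-I * (fourierFreq n s : ℂ) * (t : ℂ))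
        * cexp (I * (fourierFreq n s' : ℂ) * (u : ℂ)) * γ (t - u)) u using 1
    funext h
    rw [add_sub_cancel_left, he, ← mul_assoc, ← Complex.exp_add, ← Complex.exp_add]
    congr 3
    simp only [fourierFreq]
    push_cast
    field_simp
    ring
  have hdiff : ∀ u : ℤ, ‖(∑ t ∈ S, cexp (-I * (fourierFreq n s : ℂ) * (t : ℂ))
        * cexp (I * (fourierFreq n s' : ℂ) * (u : ℂ)) * γ (t - u)) - e u * fs‖
      ≤ ∑' h : ℤ, if u + h ∈ S then 0 else ‖γ h‖ := by
    intro u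
    have h1 := (hrow u).sub (hsf.mul_left (e u))
    rw [← h1.tsum_eq]
    have hs2 : Summable fun h : ℤ => if u + h ∈ S then 0 else ‖γ h‖ :=
      Summable.of_nonneg_of_le (fun h => by split_ifs <;> positivity)
        (fun h => by split_ifs <;> simp) hγ
    refine tsum_of_norm_bounded hs2.hasSum fun h => ?_
    split_ifs
    · simp
    · simp [hne, Complex.norm_exp]
  have htot : ‖∑ t ∈ S, ∑ u ∈ S, cexp (-I * (fourierFreq n s : ℂ) * (t : ℂ))
        * cexp (I * (fourierFreq n s' : ℂ) * (u : ℂ)) * γ (t - u)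
        - (∑ u ∈ S, e u) * fs‖ ≤ ∑' h : ℤ, |(h : ℝ)| * ‖γ h‖ := by
    rw [Finset.sum_comm, Finset.sum_mul, ← Finset.sum_sub_distrib]
    refine (norm_sum_le _ _).trans ((Finset.sum_le_sum fun u _ => hdiff u).trans ?_)
    have hs2 : ∀ u : ℤ, Summable fun h : ℤ => if u + h ∈ S then 0 else ‖γ h‖ := fun u =>
      Summable.of_nonneg_of_le (fun h => by split_ifs <;> positivity)
        (fun h => by split_ifs <;> simp) hγ
    rw [← Summable.tsum_finsetSum (fun u _ => hs2 u)]
    refine Summable.tsum_le_tsum (fun h => ?_) (summable_sum fun u _ => hs2 u) hγ'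
    have : ∑ u ∈ S, (if u + h ∈ S then 0 else ‖γ h‖)
        = ((S.filter fun u => u + h ∉ S).card : ℝ) * ‖γ h‖ := by
      rw [← nsmul_eq_mul, ← Finset.sum_const, Finset.sum_filter]
      exact Finset.sum_congr rfl fun u _ => by split_ifs <;> simp_all
    rw [this]
    exact mul_le_mul_of_nonneg_right (card_filter_add_notMem_Icc_le n h) (norm_nonneg _)
  have hsum : ∑ u ∈ S, e u = if (n : ℤ) ∣ s' - s then (n : ℂ) else 0 := sum_exp_fourierFreq hn _
  have heq : dftCov γ n s s' - (if (n : ℤ) ∣ s' - s then (2 * (Real.pi : ℂ))⁻¹ * fs else 0)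
      = (2 * (Real.pi : ℂ) * n)⁻¹ * (∑ t ∈ S, ∑ u ∈ S,
        cexp (-I * (fourierFreq n s : ℂ) * (t : ℂ))
        * cexp (I * (fourierFreq n s' : ℂ) * (u : ℂ)) * γ (t - u) - (∑ u ∈ S, e u) * fs) := by
    rw [hsum, dftCov, ← hS]
    split_ifs
    · field_simp
    · simp
  rw [heq, norm_mul]
  have hnorm : ‖(2 * (Real.pi : ℂ) * n)⁻¹‖ = (2 * Real.pi)⁻¹ * (n : ℝ)⁻¹ := by
    simp [abs_of_pos Real.pi_pos, mul_comm]
  rw [hnorm, mul_right_comm _ _ (n : ℝ)⁻¹]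
  exact mul_le_mul_of_nonneg_left htot (by have := Real.pi_pos; positivity)

end DiscreteFourier

/-! ### The least squares weights and the lower bound for `c₄ - c₂²`. -/

section Weights

variable {θ δ : ℝ} {n : ℕ}

theorem card_regIndices (θ δ : ℝ) (n : ℕ) : (regIndices θ δ n).card = bandwidth δ n := by
  unfold regIndices
  split_ifs <;> rw [Int.card_Icc] <;> omega

/-- The weight of the response at `w_s` in the ordinary least squares intercept. -/
noncomputable def olsWeight (θ δ : ℝ) (n : ℕ) (s : ℤ) : ℝ :=
  (cMoment θ δ n 4 - cMoment θ δ n 2 * (θ - fourierFreq n s) ^ 2)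
    / (bandwidth δ n * (cMoment θ δ n 4 - cMoment θ δ n 2 ^ 2))

/-- Cramer's rule for the normal equations. No invertibility is needed: for a singular design the
matrix inverse and the division both default to zero. -/
theorem olsEstimator_eq_sum {m : ℕ} (x : ℤ → (Fin m → ℝ)) (θ δ : ℝ) (j k : Fin m) (n : ℕ) :
    olsEstimator x θ δ j k n
      = ∑ s ∈ regIndices θ δ n, olsWeight θ δ n s * (periodogram x n (fourierFreq n s) j k).re := by
  rw [← Finset.sum_coe_sort]
  simp only [olsEstimator, Matrix.mulVec, dotProduct]
  refine Finset.sum_congr rfl fun s _ => ?_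
  simp only [response]
  congr 1
  -- The index `s` itself witnesses that the index set is nonempty.
  have hM : (bandwidth δ n : ℝ) ≠ 0 := by
    have : 0 < (regIndices θ δ n).card := Finset.card_pos.mpr ⟨s, s.2⟩
    rw [card_regIndices] at this
    exact_mod_cast this.ne'
  have h2 : ∑ s ∈ regIndices θ δ n, (θ - fourierFreq n s) ^ 2
      = bandwidth δ n * cMoment θ δ n 2 := by
    rw [cMoment, mul_inv_cancel_left₀ hM]
  have h4 : ∑ s ∈ regIndices θ δ n, (θ - fourierFreq n s) ^ 4
      = bandwidth δ n * cMoment θ δ n 4 := by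
    rw [cMoment, mul_inv_cancel_left₀ hM]
  have hA : (designMatrix θ δ n)ᵀ * designMatrix θ δ n
      = !![(bandwidth δ n : ℝ), bandwidth δ n * cMoment θ δ n 2;
           bandwidth δ n * cMoment θ δ n 2, bandwidth δ n * cMoment θ δ n 4] := by
    ext a b
    rw [← h2, ← h4, ← Finset.sum_coe_sort (regIndices θ δ n), ← Finset.sum_coe_sort (regIndices θ δ n)]
    fin_cases a <;> fin_cases b <;>
      simp [designMatrix, Matrix.mul_apply, card_regIndices, ← pow_add]
  rw [hA, Matrix.inv_def, Matrix.det_fin_two, Matrix.adjugate_fin_two, Matrix.mul_apply,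
    Fin.sum_univ_two, Ring.inverse_eq_inv', olsWeight]
  simp only [designMatrix, Matrix.transpose_apply, Matrix.smul_apply, Matrix.of_apply,
    Matrix.cons_val_zero, Matrix.cons_val_one, smul_eq_mul]
  have hdet : (bandwidth δ n : ℝ) * (bandwidth δ n * cMoment θ δ n 4)
      - bandwidth δ n * cMoment θ δ n 2 * (bandwidth δ n * cMoment θ δ n 2)
      = bandwidth δ n * (bandwidth δ n * (cMoment θ δ n 4 - cMoment θ δ n 2 ^ 2)) := by ring
  rw [hdet, mul_inv (bandwidth δ n : ℝ) (_ * _), div_eq_inv_mul]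
  field_simp
  ring

theorem sum_olsWeight_mul_re {m : ℕ} (f : ℝ → Matrix (Fin m) (Fin m) ℂ) (θ δ : ℝ) (j k : Fin m)
    (n : ℕ) :
    ∑ s ∈ regIndices θ δ n, olsWeight θ δ n s * (f (fourierFreq n s) j k).re
      = (cMoment θ δ n 4 * GMoment f θ δ j k n 0 - cMoment θ δ n 2 * GMoment f θ δ j k n 2)
        / (cMoment θ δ n 4 - cMoment θ δ n 2 ^ 2) := by
  simp only [GMoment, olsWeight, Finset.mul_sum, ← Finset.sum_sub_distrib, Finset.sum_div]
  refine Finset.sum_congr rfl fun s _ => ?_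
  simp only [div_eq_mul_inv, mul_inv]
  ring

/-- The main variance term, exactly, but with `1/M` still in place of `1/(δn)`: the square of the
weight's numerator produces the coefficients of the `F` sums. -/
theorem sum_olsWeight_sq_mul {m : ℕ} (f : ℝ → Matrix (Fin m) (Fin m) ℂ) (θ δ : ℝ) (j k : Fin m)
    (n : ℕ) :
    ∑ s ∈ regIndices θ δ n, (olsWeight θ δ n s : ℂ) ^ 2 * ((1 / 4) *
        (f (fourierFreq n s) j k ^ 2 + f (fourierFreq n s) k j ^ 2
          + 2 * f (fourierFreq n s) j j * f (fourierFreq n s) k k))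
      = (bandwidth δ n : ℂ)⁻¹ *
        (((cMoment θ δ n 4 : ℂ) ^ 2 * FMoment f θ δ j k n 0
            - 2 * (cMoment θ δ n 4 : ℂ) * (cMoment θ δ n 2 : ℂ) * FMoment f θ δ j k n 2
            + (cMoment θ δ n 2 : ℂ) ^ 2 * FMoment f θ δ j k n 4)
          / (4 * ((cMoment θ δ n 4 : ℂ) - (cMoment θ δ n 2 : ℂ) ^ 2) ^ 2)) := by
  simp only [FMoment, olsWeight, Finset.mul_sum, ← Finset.sum_sub_distrib,
    ← Finset.sum_add_distrib, Finset.sum_div]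
  refine Finset.sum_congr rfl fun s _ => ?_
  push_cast
  simp only [div_eq_mul_inv, mul_inv, inv_pow, mul_pow]
  ring

theorem two_mul_bandwidth_le (hδ1 : δ < 1 / 2) (n : ℕ) :
    2 * bandwidth δ n ≤ n := by
  rcases le_or_gt δ 0 with h | h
  · have : bandwidth δ n = 0 := Nat.floor_of_nonpos (mul_nonpos_of_nonpos_of_nonneg h (by positivity))
    omega
  · have h1 : (bandwidth δ n : ℝ) ≤ δ * n := Nat.floor_le (by positivity)
    have h2 : (2 * bandwidth δ n : ℝ) ≤ n := by
      have : (0 : ℝ) ≤ n := by positivity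
      nlinarith
    exact_mod_cast h2

/-- This range keeps `s` from being a multiple of `n` and puts `w_s` in `(0, π]`, so that `θ - w_s`
has constant sign for either value of `θ`. -/
theorem bounds_of_mem_regIndices (hδ1 : δ < 1 / 2) {s : ℤ} (hs : s ∈ regIndices θ δ n) :
    1 ≤ s ∧ 2 * s ≤ n := by
  have := two_mul_bandwidth_le hδ1 n
  unfold regIndices at hs
  split_ifs at hs <;> rw [Finset.mem_Icc] at hs <;> omega

theorem fourierFreq_bounds {s : ℤ} (hs : 1 ≤ s ∧ 2 * s ≤ n) :
    0 ≤ fourierFreq n s ∧ fourierFreq n s ≤ Real.pi := by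
  have hn : (0 : ℝ) < n := by
    have : 0 < n := by omega
    exact_mod_cast this
  have h1 : (1 : ℝ) ≤ s := by exact_mod_cast hs.1
  have h2 : 2 * (s : ℝ) ≤ n := by exact_mod_cast hs.2
  have hp := Real.pi_pos
  unfold fourierFreq
  constructor
  · positivity
  · rw [div_le_iff₀ hn]; nlinarith

theorem abs_sub_fourierFreq_le (hθ : θ = 0 ∨ θ = Real.pi) {s : ℤ} (hs : 1 ≤ s ∧ 2 * s ≤ n) :
    |θ - fourierFreq n s| ≤ Real.pi := by
  obtain ⟨h1, h2⟩ := fourierFreq_bounds hs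
  rw [abs_le]
  rcases hθ with rfl | rfl <;> constructor <;> linarith

theorem sub_fourierFreq_mul_nonneg (hθ : θ = 0 ∨ θ = Real.pi) {s r : ℤ} (hs : 1 ≤ s ∧ 2 * s ≤ n)
    (hr : 1 ≤ r ∧ 2 * r ≤ n) :
    0 ≤ (θ - fourierFreq n s) * (θ - fourierFreq n r) := by
  obtain ⟨h1, h2⟩ := fourierFreq_bounds hs
  obtain ⟨h3, h4⟩ := fourierFreq_bounds hr
  rcases hθ with rfl | rfl
  · exact mul_nonneg_of_nonpos_of_nonpos (by linarith) (by linarith)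
  · exact mul_nonneg (by linarith) (by linarith)

theorem abs_cMoment_le (hθ : θ = 0 ∨ θ = Real.pi) (hδ1 : δ < 1 / 2) (n q : ℕ) :
    |cMoment θ δ n q| ≤ Real.pi ^ q := by
  have hp := Real.pi_pos
  rw [cMoment, abs_mul, abs_of_nonneg (by positivity : (0 : ℝ) ≤ (bandwidth δ n : ℝ)⁻¹)]
  have h1 : |∑ s ∈ regIndices θ δ n, (θ - fourierFreq n s) ^ q|
      ≤ bandwidth δ n * Real.pi ^ q := by
    refine (Finset.abs_sum_le_sum_abs _ _).trans ?_
    rw [← card_regIndices θ, ← nsmul_eq_mul]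
    refine Finset.sum_le_card_nsmul _ _ _ fun s hs => ?_
    rw [abs_pow]
    exact pow_le_pow_left₀ (abs_nonneg _)
      (abs_sub_fourierFreq_le hθ (bounds_of_mem_regIndices hδ1 hs)) q
  rcases Nat.eq_zero_or_pos (bandwidth δ n) with h0 | h0
  · rw [h0]; simp; positivity
  · have : (0 : ℝ) < bandwidth δ n := by exact_mod_cast h0
    rw [inv_mul_le_iff₀ this]
    exact h1

theorem sum_sum_range_sub_sq (M : ℕ) :
    ∑ i ∈ Finset.range M, ∑ j ∈ Finset.range M, ((i : ℝ) - j) ^ 2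
      = (M : ℝ) ^ 2 * ((M : ℝ) ^ 2 - 1) / 6 := by
  have h1 : ∀ M : ℕ, ∑ i ∈ Finset.range M, (i : ℝ) = M * (M - 1) / 2 := by
    intro M
    induction M with
    | zero => simp
    | succ k ih => rw [Finset.sum_range_succ, ih]; push_cast; ring
  have h2 : ∀ M : ℕ, ∑ i ∈ Finset.range M, (i : ℝ) ^ 2 = M * (M - 1) * (2 * M - 1) / 6 := by
    intro M
    induction M with
    | zero => simp
    | succ k ih => rw [Finset.sum_range_succ, ih]; push_cast; ring
  simp only [sub_sq, Finset.sum_add_distrib, Finset.sum_sub_distrib, Finset.sum_const,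
    Finset.card_range, nsmul_eq_mul, ← Finset.mul_sum, ← Finset.sum_mul, h1, h2]
  ring

theorem sum_sum_Icc_sub_sq (a b : ℤ) (M : ℕ) (hab : b = a + M - 1) :
    ∑ s ∈ Finset.Icc a b, ∑ r ∈ Finset.Icc a b, ((s : ℝ) - r) ^ 2
      = (M : ℝ) ^ 2 * ((M : ℝ) ^ 2 - 1) / 6 := by
  rw [← sum_sum_range_sub_sq]
  have key : ∀ F : ℤ → ℝ, ∑ s ∈ Finset.Icc a b, F s = ∑ i ∈ Finset.range M, F (a + i) := by
    intro F
    symm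
    refine Finset.sum_bij (fun i _ => a + (i : ℤ)) ?_ ?_ ?_ ?_
    · intro i hi; simp at hi ⊢; omega
    · intro a _ b _ h; simpa using h
    · intro b hb
      simp only [Finset.mem_Icc] at hb
      exact ⟨(b - a).toNat, by simp; omega, by omega⟩
    · intro i _; rfl
  simp only [key]
  refine Finset.sum_congr rfl fun i _ => Finset.sum_congr rfl fun l _ => ?_
  push_cast; ring

theorem sum_sum_regIndices_sub_sq (θ δ : ℝ) (n : ℕ) :
    ∑ s ∈ regIndices θ δ n, ∑ r ∈ regIndices θ δ n, ((s : ℝ) - r) ^ 2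
      = (bandwidth δ n : ℝ) ^ 2 * ((bandwidth δ n : ℝ) ^ 2 - 1) / 6 := by
  unfold regIndices
  split_ifs
  · exact sum_sum_Icc_sub_sq _ _ _ (by omega)
  · exact sum_sum_Icc_sub_sq _ _ _ (by omega)

/-- With `x_s = θ - w_s`, the empirical variance of `x_s²` is a double sum of `(x_s² - x_r²)²`.
Since the `x_s` share a sign, each term is at least `(x_s - x_r)⁴`, and Cauchy–Schwarz reduces the
fourth powers to `∑∑ (s - r)²`, which is explicit. -/
theorem le_cMoment_sub (hθ : θ = 0 ∨ θ = Real.pi) (hδ1 : δ < 1 / 2) (hM : bandwidth δ n ≠ 0) :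
    (1 / 2) * (2 * Real.pi / n) ^ 4 * (((bandwidth δ n : ℝ) ^ 2 - 1) / 6) ^ 2
      ≤ cMoment θ δ n 4 - cMoment θ δ n 2 ^ 2 := by
  have hMr : (0 : ℝ) < bandwidth δ n := by exact_mod_cast Nat.pos_of_ne_zero hM
  set S := regIndices θ δ n with hS
  set M : ℝ := ((bandwidth δ n : ℕ) : ℝ) with hMdef
  have hcard : (S.card : ℝ) = M := by rw [hS, card_regIndices]
  have hvar : 2 * M ^ 2 * (cMoment θ δ n 4 - cMoment θ δ n 2 ^ 2)
      = ∑ p ∈ S ×ˢ S, ((θ - fourierFreq n p.1) ^ 2 - (θ - fourierFreq n p.2) ^ 2) ^ 2 := by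
    rw [Finset.sum_product]
    simp only [sub_sq ((_ : ℝ) ^ 2), Finset.sum_add_distrib, Finset.sum_sub_distrib,
      Finset.sum_const, nsmul_eq_mul, ← Finset.mul_sum, ← Finset.sum_mul, hcard, ← pow_mul,
      Nat.reduceMul]
    have h2 : ∑ s ∈ S, (θ - fourierFreq n s) ^ 2 = M * cMoment θ δ n 2 := by
      rw [cMoment, mul_inv_cancel_left₀ hMr.ne']
    have h4 : ∑ s ∈ S, (θ - fourierFreq n s) ^ 4 = M * cMoment θ δ n 4 := by
      rw [cMoment, mul_inv_cancel_left₀ hMr.ne']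
    rw [h2, h4]
    ring
  have hlow : ∑ p ∈ S ×ˢ S, ((2 * Real.pi / n) ^ 2 * ((p.1 : ℝ) - p.2) ^ 2) ^ 2
      ≤ ∑ p ∈ S ×ˢ S, ((θ - fourierFreq n p.1) ^ 2 - (θ - fourierFreq n p.2) ^ 2) ^ 2 := by
    refine Finset.sum_le_sum fun p hp => ?_
    rw [Finset.mem_product] at hp
    have h0 := sub_fourierFreq_mul_nonneg hθ (bounds_of_mem_regIndices hδ1 hp.1)
      (bounds_of_mem_regIndices hδ1 hp.2)
    have hd : (2 * Real.pi / n) ^ 2 * ((p.1 : ℝ) - p.2) ^ 2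
        = ((θ - fourierFreq n p.1) - (θ - fourierFreq n p.2)) ^ 2 := by
      unfold fourierFreq; ring
    rw [hd]
    generalize θ - fourierFreq n p.1 = x at *
    generalize θ - fourierFreq n p.2 = y at *
    -- `(x² - y²)² - (x - y)⁴ = 4xy (x - y)²`.
    nlinarith [mul_nonneg h0 (sq_nonneg (x - y))]
  have hjensen := sq_sum_le_card_mul_sum_sq (s := S ×ˢ S)
    (f := fun p => (2 * Real.pi / n) ^ 2 * ((p.1 : ℝ) - p.2) ^ 2)
  rw [← Finset.mul_sum, Finset.card_product, Finset.sum_product (f := fun p : ℤ × ℤ =>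
    ((p.1 : ℝ) - p.2) ^ 2)] at hjensen
  simp only at hjensen
  rw [hS, sum_sum_regIndices_sub_sq, ← hS] at hjensen
  push_cast at hjensen
  rw [hcard] at hjensen
  have hfin : ((2 * Real.pi / n) ^ 2 * (M ^ 2 * (M ^ 2 - 1) / 6)) ^ 2
      ≤ M * M * (2 * M ^ 2 * (cMoment θ δ n 4 - cMoment θ δ n 2 ^ 2)) := by
    rw [hvar]
    exact hjensen.trans (mul_le_mul_of_nonneg_left hlow (by positivity))
  have hM4 : 0 < 2 * M ^ 4 := by positivity
  refine le_of_mul_le_mul_left ?_ hM4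
  calc _ = ((2 * Real.pi / n) ^ 2 * (M ^ 2 * (M ^ 2 - 1) / 6)) ^ 2 := by ring
    _ ≤ _ := hfin
    _ = _ := by ring

/-- The spare `1` is what gives `M² - 1 ≥ (δn/2)²` in the lower bound for `c₄ - c₂²`. -/
theorem eventually_le_bandwidth (hδ0 : 0 < δ) :
    ∀ᶠ n : ℕ in atTop, δ * n / 2 + 1 ≤ (bandwidth δ n : ℝ) := by
  have ht : Tendsto (fun n : ℕ => δ * (n : ℝ)) atTop atTop :=
    tendsto_natCast_atTop_atTop.const_mul_atTop hδ0
  filter_upwards [ht.eventually_ge_atTop 4] with n hn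
  have := Nat.lt_floor_add_one (δ * n)
  unfold bandwidth
  linarith

theorem exists_eventually_le_cMoment_sub (hθ : θ = 0 ∨ θ = Real.pi) (hδ0 : 0 < δ)
    (hδ1 : δ < 1 / 2) :
    ∃ κ : ℝ, 0 < κ ∧ ∀ᶠ n : ℕ in atTop, κ ≤ cMoment θ δ n 4 - cMoment θ δ n 2 ^ 2 := by
  have hp := Real.pi_pos
  refine ⟨(1 / 2) * (2 * Real.pi) ^ 4 * (δ ^ 2 / 24) ^ 2, by positivity, ?_⟩
  filter_upwards [eventually_le_bandwidth hδ0, eventually_gt_atTop 0] with n hn hn0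
  have hnr : (0 : ℝ) < n := by exact_mod_cast hn0
  have hM : bandwidth δ n ≠ 0 := by
    intro h
    rw [h] at hn
    have : 0 < δ * n := by positivity
    push_cast at hn; linarith
  refine le_trans ?_ (le_cMoment_sub hθ hδ1 hM)
  have h1 : δ ^ 2 * (n : ℝ) ^ 2 / 24 ≤ ((bandwidth δ n : ℝ) ^ 2 - 1) / 6 := by
    have : 0 < δ * n := by positivity
    nlinarith
  calc (1 / 2) * (2 * Real.pi) ^ 4 * (δ ^ 2 / 24) ^ 2
      = (1 / 2) * (2 * Real.pi / n) ^ 4 * (δ ^ 2 * (n : ℝ) ^ 2 / 24) ^ 2 := by field_simp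
    _ ≤ _ := by gcongr

theorem exists_eventually_abs_olsWeight_le (hθ : θ = 0 ∨ θ = Real.pi) (hδ0 : 0 < δ)
    (hδ1 : δ < 1 / 2) :
    ∃ C : ℝ, 0 ≤ C ∧ ∀ᶠ n : ℕ in atTop, ∀ s ∈ regIndices θ δ n,
      |olsWeight θ δ n s| ≤ C * (n : ℝ)⁻¹ := by
  obtain ⟨κ, hκ, hev⟩ := exists_eventually_le_cMoment_sub hθ hδ0 hδ1
  have hp := Real.pi_pos
  refine ⟨(2 * Real.pi ^ 4) / (δ / 2 * κ), by positivity, ?_⟩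
  filter_upwards [hev, eventually_le_bandwidth hδ0, eventually_gt_atTop 0] with n h1 h2 hn0 s hs
  have hnr : (0 : ℝ) < n := by exact_mod_cast hn0
  have hx := abs_sub_fourierFreq_le hθ (bounds_of_mem_regIndices hδ1 hs)
  have hnum : |cMoment θ δ n 4 - cMoment θ δ n 2 * (θ - fourierFreq n s) ^ 2|
      ≤ 2 * Real.pi ^ 4 := by
    have e1 := abs_cMoment_le hθ hδ1 n 4
    have e2 := abs_cMoment_le hθ hδ1 n 2
    have e3 : |cMoment θ δ n 2 * (θ - fourierFreq n s) ^ 2| ≤ Real.pi ^ 2 * Real.pi ^ 2 := by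
      rw [abs_mul, abs_pow]
      gcongr
    have := abs_sub (cMoment θ δ n 4) (cMoment θ δ n 2 * (θ - fourierFreq n s) ^ 2)
    nlinarith
  have hden : δ / 2 * κ * n ≤ bandwidth δ n * (cMoment θ δ n 4 - cMoment θ δ n 2 ^ 2) := by
    calc δ / 2 * κ * n = (δ * n / 2) * κ := by ring
      _ ≤ _ := by
        gcongr
        linarith
  have hpos : 0 < δ / 2 * κ * n := by positivity
  rw [olsWeight, abs_div, abs_of_pos (hpos.trans_le hden), ← div_eq_mul_inv, div_div]
  gcongr

end Weights

/-! ### The periodogram as a quadratic form. -/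

section Periodogram

open Complex

theorem sum_sum_filter_shift {M : Type*} [AddCommMonoid M] (n : ℕ) (F : ℤ → ℤ → M) :
    ∑ h ∈ Finset.Ioo (-(n : ℤ)) n, ∑ u ∈ (Finset.Icc (1 : ℤ) n).filter
        (fun u => u + h ∈ Finset.Icc (1 : ℤ) n), F (u + h) u
      = ∑ t ∈ Finset.Icc (1 : ℤ) n, ∑ u ∈ Finset.Icc (1 : ℤ) n, F t u := by
  rw [Finset.sum_sigma', Finset.sum_sigma']
  refine Finset.sum_nbij' (fun p => ⟨p.2 + p.1, p.2⟩) (fun p => ⟨p.1 - p.2, p.2⟩) ?_ ?_ ?_ ?_ ?_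
  · rintro ⟨h, u⟩ hp; simp at hp ⊢; omega
  · rintro ⟨t, u⟩ hp; simp at hp ⊢; omega
  · rintro ⟨h, u⟩ _; simp
  · rintro ⟨t, u⟩ _; simp
  · rintro ⟨h, u⟩ _; rfl

variable {m : ℕ}

theorem periodogram_eq_sum_sum (x : ℤ → (Fin m → ℝ)) (n : ℕ) (w : ℝ) (j k : Fin m) :
    periodogram x n w j k = (2 * (Real.pi : ℂ) * n)⁻¹ *
      ∑ t ∈ Finset.Icc (1 : ℤ) n, ∑ u ∈ Finset.Icc (1 : ℤ) n,
        (cexp (-I * w * t) * (x t j - sampleMean x n j : ℝ))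
          * (cexp (I * w * u) * (x u k - sampleMean x n k : ℝ)) := by
  rw [← sum_sum_filter_shift]
  simp only [periodogram, sampleAutocov, Matrix.of_apply]
  rw [mul_inv (2 * (Real.pi : ℂ)), mul_assoc (2 * (Real.pi : ℂ))⁻¹, Finset.mul_sum (a := (n : ℂ)⁻¹)]
  congr 1
  refine Finset.sum_congr rfl fun h _ => ?_
  push_cast
  rw [mul_left_comm, Finset.mul_sum]
  congr 1
  refine Finset.sum_congr rfl fun u _ => ?_
  have : cexp (-I * w * h) = cexp (-I * w * (u + h)) * cexp (I * w * u) := by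
    rw [← Complex.exp_add]; ring_nf
  rw [this]
  ring

theorem sum_exp_mul_sub_const {n : ℕ} {w : ℂ}
    (hw : ∑ t ∈ Finset.Icc (1 : ℤ) n, cexp (w * t) = 0) (y : ℤ → ℝ) (c d : ℝ) :
    ∑ t ∈ Finset.Icc (1 : ℤ) n, cexp (w * t) * (y t - c : ℝ)
      = ∑ t ∈ Finset.Icc (1 : ℤ) n, cexp (w * t) * (y t - d : ℝ) := by
  push_cast
  simp only [mul_sub, Finset.sum_sub_distrib, ← Finset.sum_mul, hw, zero_mul]

theorem re_mul_sum_sum_exp_mul (n : ℕ) (w : ℝ) (A B : ℤ → ℝ) :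
    ((2 * (Real.pi : ℂ) * n)⁻¹ *
      ∑ t ∈ Finset.Icc (1 : ℤ) n, ∑ u ∈ Finset.Icc (1 : ℤ) n,
        (cexp (-I * w * t) * (A t : ℝ)) * (cexp (I * w * u) * (B u : ℝ))).re
      = (2 * Real.pi * n)⁻¹ * ∑ t ∈ Finset.Icc (1 : ℤ) n, ∑ u ∈ Finset.Icc (1 : ℤ) n,
        Real.cos (w * (t - u)) * (A t * B u) := by
  have hc : (2 * (Real.pi : ℂ) * n)⁻¹ = (((2 * Real.pi * n)⁻¹ : ℝ) : ℂ) := by push_cast; rfl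
  rw [hc, Complex.re_ofReal_mul, Complex.re_sum]
  congr 1
  refine Finset.sum_congr rfl fun t _ => ?_
  rw [Complex.re_sum]
  refine Finset.sum_congr rfl fun u _ => ?_
  have he : (cexp (-I * (w : ℂ) * t) * (A t : ℝ)) * (cexp (I * (w : ℂ) * u) * (B u : ℝ))
      = cexp ((-(w * (t - u)) : ℝ) * I) * ((A t * B u : ℝ) : ℂ) := by
    rw [mul_mul_mul_comm, ← Complex.exp_add]
    push_cast
    ring_nf
  rw [he, Complex.re_mul_ofReal, Complex.exp_ofReal_mul_I_re, Real.cos_neg]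

theorem re_periodogram (x : ℤ → (Fin m → ℝ)) (n : ℕ) (w : ℝ) (j k : Fin m) :
    (periodogram x n w j k).re = (2 * Real.pi * n)⁻¹ *
      ∑ t ∈ Finset.Icc (1 : ℤ) n, ∑ u ∈ Finset.Icc (1 : ℤ) n,
        Real.cos (w * (t - u)) * ((x t j - sampleMean x n j) * (x u k - sampleMean x n k)) := by
  rw [periodogram_eq_sum_sum, re_mul_sum_sum_exp_mul]

/-- At a nonzero Fourier frequency, the centring constants in the periodogram are irrelevant. -/
theorem re_periodogram_fourierFreq (x : ℤ → (Fin m → ℝ)) {n : ℕ} (hn : n ≠ 0) {s : ℤ}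
    (hs : ¬ (n : ℤ) ∣ s) (μ : Fin m → ℝ) (j k : Fin m) :
    (periodogram x n (fourierFreq n s) j k).re = (2 * Real.pi * n)⁻¹ *
      ∑ t ∈ Finset.Icc (1 : ℤ) n, ∑ u ∈ Finset.Icc (1 : ℤ) n,
        Real.cos (fourierFreq n s * (t - u)) * ((x t j - μ j) * (x u k - μ k)) := by
  have h1 : ∑ t ∈ Finset.Icc (1 : ℤ) n, cexp (I * (fourierFreq n s : ℂ) * t) = 0 := by
    rw [sum_exp_fourierFreq hn, if_neg hs]
  have h2 : ∑ t ∈ Finset.Icc (1 : ℤ) n, cexp (-I * (fourierFreq n s : ℂ) * t) = 0 := by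
    have h := sum_exp_fourierFreq hn (-s)
    rw [if_neg (by rwa [dvd_neg])] at h
    rw [← h]
    refine Finset.sum_congr rfl fun t _ => ?_
    simp [fourierFreq, neg_div]
  rw [periodogram_eq_sum_sum, ← Finset.sum_mul_sum, sum_exp_mul_sub_const h1 _ _ (μ k),
    sum_exp_mul_sub_const h2 _ _ (μ j), Finset.sum_mul_sum, re_mul_sum_sum_exp_mul]

theorem re_dftCov_self (γ : ℤ → ℝ) (n : ℕ) (s : ℤ) :
    (dftCov (fun h => (γ h : ℂ)) n s s).re = (2 * Real.pi * n)⁻¹ *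
      ∑ t ∈ Finset.Icc (1 : ℤ) n, ∑ u ∈ Finset.Icc (1 : ℤ) n,
        Real.cos (fourierFreq n s * (t - u)) * γ (t - u) := by
  have hc : (2 * (Real.pi : ℂ) * n)⁻¹ = (((2 * Real.pi * n)⁻¹ : ℝ) : ℂ) := by push_cast; rfl
  rw [dftCov, hc, Complex.re_ofReal_mul, Complex.re_sum]
  congr 1
  refine Finset.sum_congr rfl fun t _ => ?_
  rw [Complex.re_sum]
  refine Finset.sum_congr rfl fun u _ => ?_
  have he : cexp (-I * (fourierFreq n s : ℂ) * t) * cexp (I * (fourierFreq n s : ℂ) * u)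
      = cexp ((-(fourierFreq n s * (t - u)) : ℝ) * I) := by
    rw [← Complex.exp_add]
    push_cast
    ring_nf
  rw [he, Complex.re_mul_ofReal, Complex.exp_ofReal_mul_I_re, Real.cos_neg]

theorem sum_four_parallel (S : Finset ℤ) (f g : ℤ → ℤ → ℂ) :
    ∑ t ∈ S, ∑ u ∈ S, ∑ t' ∈ S, ∑ u' ∈ S, f t t' * g u u'
      = (∑ t ∈ S, ∑ t' ∈ S, f t t') * ∑ u ∈ S, ∑ u' ∈ S, g u u' := by
  simp only [← Finset.mul_sum, ← Finset.sum_mul]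

theorem sum_four_crossed (S : Finset ℤ) (f g : ℤ → ℤ → ℂ) :
    ∑ t ∈ S, ∑ u ∈ S, ∑ t' ∈ S, ∑ u' ∈ S, f t u' * g u t'
      = (∑ t ∈ S, ∑ u' ∈ S, f t u') * ∑ u ∈ S, ∑ t' ∈ S, g u t' := by
  simp only [← Finset.mul_sum, ← Finset.sum_mul]

theorem ofReal_cos_fourierFreq_mul_sub (n : ℕ) (s t u : ℤ) :
    ((Real.cos (fourierFreq n s * (t - u)) : ℝ) : ℂ)
      = (cexp (-I * (fourierFreq n s : ℂ) * t) * cexp (I * (fourierFreq n s : ℂ) * u)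
        + cexp (I * (fourierFreq n s : ℂ) * t) * cexp (-I * (fourierFreq n s : ℂ) * u)) / 2 := by
  rw [← Complex.exp_add, ← Complex.exp_add, Complex.ofReal_cos, Complex.cos]
  push_cast
  ring_nf

theorem fourierFreq_neg (n : ℕ) (s : ℤ) : fourierFreq n (-s) = -fourierFreq n s := by
  simp [fourierFreq, neg_div]

/-- The quadruple sum giving the covariance of two periodogram ordinates, in terms of the
covariances of the discrete Fourier transforms. -/
theorem sum_cos_mul_cos_eq_dftCov (a b c d : ℤ → ℝ) (n : ℕ) (s r : ℤ) :
    (((2 * Real.pi * n)⁻¹ * ((2 * Real.pi * n)⁻¹ *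
      ∑ t ∈ Finset.Icc (1 : ℤ) n, ∑ u ∈ Finset.Icc (1 : ℤ) n,
        ∑ t' ∈ Finset.Icc (1 : ℤ) n, ∑ u' ∈ Finset.Icc (1 : ℤ) n,
        Real.cos (fourierFreq n s * (t - u)) * (Real.cos (fourierFreq n r * (t' - u')) *
          (a (t - t') * b (u - u') + c (t - u') * d (u - t')))) : ℝ) : ℂ)
      = (1 / 4) *
        (dftCov (fun h => (a h : ℂ)) n s r * dftCov (fun h => (b h : ℂ)) n (-s) (-r)
        + dftCov (fun h => (a h : ℂ)) n s (-r) * dftCov (fun h => (b h : ℂ)) n (-s) r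
        + dftCov (fun h => (a h : ℂ)) n (-s) r * dftCov (fun h => (b h : ℂ)) n s (-r)
        + dftCov (fun h => (a h : ℂ)) n (-s) (-r) * dftCov (fun h => (b h : ℂ)) n s r
        + dftCov (fun h => (c h : ℂ)) n s r * dftCov (fun h => (d h : ℂ)) n (-s) (-r)
        + dftCov (fun h => (c h : ℂ)) n s (-r) * dftCov (fun h => (d h : ℂ)) n (-s) r
        + dftCov (fun h => (c h : ℂ)) n (-s) r * dftCov (fun h => (d h : ℂ)) n s (-r)
        + dftCov (fun h => (c h : ℂ)) n (-s) (-r) * dftCov (fun h => (d h : ℂ)) n s r) := by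
  have hc : ∀ z x y : ℂ, z * x * (z * y) = z * (z * (x * y)) := by intros; ring
  simp only [dftCov, hc, ← mul_add]
  rw [mul_left_comm (1 / 4 : ℂ), mul_left_comm (1 / 4 : ℂ)]
  -- Each cosine is half a sum of two exponentials, so each of the two pairings yields four
  -- quadruple sums, and each of these factors into two double sums.
  rw [← sum_four_parallel, ← sum_four_parallel, ← sum_four_parallel, ← sum_four_parallel,
    ← sum_four_crossed, ← sum_four_crossed, ← sum_four_crossed, ← sum_four_crossed]
  simp only [Complex.ofReal_mul, Complex.ofReal_sum, Complex.ofReal_add,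
    ofReal_cos_fourierFreq_mul_sub, Complex.ofReal_inv, Complex.ofReal_natCast,
    Complex.ofReal_ofNat]
  congr 2
  simp only [← Finset.sum_add_distrib, Finset.mul_sum]
  refine Finset.sum_congr rfl fun t _ => Finset.sum_congr rfl fun u _ =>
    Finset.sum_congr rfl fun t' _ => Finset.sum_congr rfl fun u' _ => ?_
  simp only [fourierFreq_neg, Complex.ofReal_neg, mul_neg, neg_mul, neg_neg]
  ring

end Periodogram

/-! ### Exact moments of the ordinates for a stationary Gaussian series. -/

section StationaryGaussian

variable {Ω : Type*} [MeasurableSpace Ω] {P : Measure Ω} {m : ℕ} {X : ℤ → Ω → (Fin m → ℝ)}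

/-- Flattens the vector series to a real process indexed by time and coordinate, the setting of
Isserlis' formula. -/
theorem isGaussianProcess_coord (hgauss : IsGaussianProcess X P) :
    IsGaussianProcess (fun (p : ℤ × Fin m) ω => X p.1 ω p.2) P :=
  hgauss.of_isGaussianProcess fun p => ⟨{p.1},
    (ContinuousLinearMap.proj (R := ℝ) (φ := fun _ : Fin m => ℝ) p.2).comp
      (ContinuousLinearMap.proj (R := ℝ) (φ := fun _ : ({p.1} : Finset ℤ) => Fin m → ℝ)
        ⟨p.1, Finset.mem_singleton_self _⟩), fun _ => rfl⟩

theorem covariance_eq_autocov (hstat : IsStrictlyStationary X P) (t u : ℤ) (a b : Fin m) :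
    covariance (fun ω => X t ω a) (fun ω => X u ω b) P = autocov X P (t - u) a b := by
  -- Shifting these two times by `u` gives `t` and `u`.
  set S : Finset ℤ := {t - u, 0} with hS
  have h := hstat S u
  let i : S := ⟨t - u, by simp [hS]⟩
  let l : S := ⟨0, by simp [hS]⟩
  have hφ : Measurable fun y : S → Fin m → ℝ => y i a := by fun_prop
  have hψ : Measurable fun y : S → Fin m → ℝ => y l b := by fun_prop
  have e1 := covariance_map_fun (hφ.aestronglyMeasurable) (hψ.aestronglyMeasurable)
    h.aemeasurable_fst
  have e2 := covariance_map_fun (hφ.aestronglyMeasurable) (hψ.aestronglyMeasurable)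
    h.aemeasurable_snd
  rw [h.map_eq] at e1
  have e3 := e1.symm.trans e2
  simpa [autocov, i, l] using e3

theorem integral_eq_integral_zero (hstat : IsStrictlyStationary X P) (t : ℤ) (a : Fin m) :
    ∫ ω, X t ω a ∂P = ∫ ω, X 0 ω a ∂P := by
  have h := (hstat {0} t).comp
    (u := fun y : ({0} : Finset ℤ) → Fin m → ℝ => y ⟨0, Finset.mem_singleton_self _⟩ a)
    (by fun_prop)
  simpa [Function.comp_def] using h.integral_eq

theorem autocov_neg (hstat : IsStrictlyStationary X P) (h : ℤ) (a b : Fin m) :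
    autocov X P (-h) a b = autocov X P h b a := by
  have := covariance_eq_autocov hstat 0 h a b
  rw [zero_sub] at this
  rw [← this, covariance_comm]
  rfl

theorem re_periodogram_eq_centered (hstat : IsStrictlyStationary X P) {n : ℕ} (hn : n ≠ 0) {s : ℤ}
    (hs : ¬ (n : ℤ) ∣ s) (j k : Fin m) (ω : Ω) :
    (periodogram (fun t => X t ω) n (fourierFreq n s) j k).re = (2 * Real.pi * n)⁻¹ *
      ∑ t ∈ Finset.Icc (1 : ℤ) n, ∑ u ∈ Finset.Icc (1 : ℤ) n,
        Real.cos (fourierFreq n s * (t - u)) *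
          (centeredProcess (fun (p : ℤ × Fin m) ω => X p.1 ω p.2) P (t, j) ω
            * centeredProcess (fun (p : ℤ × Fin m) ω => X p.1 ω p.2) P (u, k) ω) := by
  rw [re_periodogram_fourierFreq _ hn hs (fun a => ∫ ω, X 0 ω a ∂P)]
  simp only [centeredProcess, integral_eq_integral_zero hstat]

theorem holderTriple_four_four_two : ENNReal.HolderTriple 4 4 2 := ⟨by
  rw [show (4 : ENNReal) = 2 * 2 by norm_num, ENNReal.mul_inv (by simp) (by simp), ← two_mul,
    ← mul_assoc, ENNReal.mul_inv_cancel (by simp) (by simp), one_mul]⟩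

/-- Gaussian coordinates and their sample means lie in `L⁴`, so products of two centred coordinates
lie in `L²` by Hölder. -/
theorem memLp_re_periodogram (hgauss : IsGaussianProcess X P) (n : ℕ) (w : ℝ) (j k : Fin m) :
    MemLp (fun ω => (periodogram (fun t => X t ω) n w j k).re) 2 P := by
  have hX : ∀ t a, MemLp (fun ω => X t ω a) 4 P := fun t a =>
    ((isGaussianProcess_coord hgauss).hasGaussianLaw_eval (t, a)).memLp (by simp)
  have hc : ∀ t a, MemLp (fun ω => X t ω a - sampleMean (fun t => X t ω) n a) 4 P := by
    intro t a
    refine (hX t a).sub ?_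
    simp only [sampleMean, Pi.smul_apply, Finset.sum_apply, smul_eq_mul]
    exact (memLp_finsetSum _ fun i _ => hX i a).const_mul _
  have hprod : ∀ t u, MemLp (fun ω => (X t ω j - sampleMean (fun t => X t ω) n j)
      * (X u ω k - sampleMean (fun t => X t ω) n k)) 2 P := fun t u =>
    (hc u k).mul' (hpqr := holderTriple_four_four_two) (hc t j)
  simp only [re_periodogram]
  exact (memLp_finsetSum _ fun t _ => memLp_finsetSum _ fun u _ =>
    (hprod t u).const_mul _).const_mul _

theorem memLp_olsEstimator (hgauss : IsGaussianProcess X P) (θ δ : ℝ) (j k : Fin m) (n : ℕ) :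
    MemLp (fun ω => olsEstimator (fun t => X t ω) θ δ j k n) 2 P := by
  simp only [olsEstimator_eq_sum]
  exact memLp_finsetSum _ fun s _ => (memLp_re_periodogram hgauss n _ j k).const_mul _

theorem integral_re_periodogram (hstat : IsStrictlyStationary X P)
    (hgauss : IsGaussianProcess X P) {n : ℕ} (hn : n ≠ 0) {s : ℤ} (hs : ¬ (n : ℤ) ∣ s)
    (j k : Fin m) :
    ∫ ω, (periodogram (fun t => X t ω) n (fourierFreq n s) j k).re ∂P
      = (dftCov (fun h => (autocov X P h j k : ℂ)) n s s).re := by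
  have hY := isGaussianProcess_coord hgauss
  have := hgauss.isProbabilityMeasure
  have hint : ∀ a b : ℤ × Fin m, Integrable (fun ω =>
      centeredProcess (fun (p : ℤ × Fin m) ω => X p.1 ω p.2) P a ω
            * centeredProcess (fun (p : ℤ × Fin m) ω => X p.1 ω p.2) P b ω) P := fun a b =>
    (IsGaussianProcess.memLp_centered_mul hY a b (p := 2) (by simp)).integrable (by norm_num)
  simp only [re_periodogram_eq_centered hstat hn hs]
  rw [re_dftCov_self, integral_const_mul, integral_finsetSum _ fun t _ =>
    integrable_finsetSum _ fun u _ => (hint _ _).const_mul _]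
  congr 1
  refine Finset.sum_congr rfl fun t _ => ?_
  rw [integral_finsetSum _ fun u _ => (hint _ _).const_mul _]
  refine Finset.sum_congr rfl fun u _ => ?_
  rw [integral_const_mul, integral_centered_mul, covariance_eq_autocov hstat]

theorem covariance_re_periodogram (hstat : IsStrictlyStationary X P)
    (hgauss : IsGaussianProcess X P) {n : ℕ} (hn : n ≠ 0) {s r : ℤ} (hs : ¬ (n : ℤ) ∣ s)
    (hr : ¬ (n : ℤ) ∣ r) (j k : Fin m) :
    covariance (fun ω => (periodogram (fun t => X t ω) n (fourierFreq n s) j k).re)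
        (fun ω => (periodogram (fun t => X t ω) n (fourierFreq n r) j k).re) P
      = (2 * Real.pi * n)⁻¹ * ((2 * Real.pi * n)⁻¹ *
      ∑ t ∈ Finset.Icc (1 : ℤ) n, ∑ u ∈ Finset.Icc (1 : ℤ) n,
        ∑ t' ∈ Finset.Icc (1 : ℤ) n, ∑ u' ∈ Finset.Icc (1 : ℤ) n,
        Real.cos (fourierFreq n s * (t - u)) * (Real.cos (fourierFreq n r * (t' - u')) *
          (autocov X P (t - t') j j * autocov X P (u - u') k k
            + autocov X P (t - u') j k * autocov X P (u - t') k j))) := by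
  have hY := isGaussianProcess_coord hgauss
  have := hgauss.isProbabilityMeasure
  have hm : ∀ (c : ℝ) (a b : ℤ × Fin m), MemLp (fun ω =>
      c * (centeredProcess (fun (p : ℤ × Fin m) ω => X p.1 ω p.2) P a ω
            * centeredProcess (fun (p : ℤ × Fin m) ω => X p.1 ω p.2) P b ω)) 2 P := fun c a b =>
    (IsGaussianProcess.memLp_centered_mul hY a b (by simp)).const_mul c
  simp only [re_periodogram_eq_centered hstat hn hs, re_periodogram_eq_centered hstat hn hr,
    covariance_const_mul_left, covariance_const_mul_right]
  congr 2
  rw [covariance_fun_sum_left' (fun t _ => memLp_finsetSum _ fun u _ => hm _ _ _)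
    (memLp_finsetSum _ fun t _ => memLp_finsetSum _ fun u _ => hm _ _ _)]
  refine Finset.sum_congr rfl fun t _ => ?_
  rw [covariance_fun_sum_left' (fun u _ => hm _ _ _)
    (memLp_finsetSum _ fun t _ => memLp_finsetSum _ fun u _ => hm _ _ _)]
  refine Finset.sum_congr rfl fun u _ => ?_
  rw [covariance_fun_sum_right' (fun t _ => memLp_finsetSum _ fun u _ => hm _ _ _) (hm _ _ _)]
  refine Finset.sum_congr rfl fun t' _ => ?_
  rw [covariance_fun_sum_right' (fun u _ => hm _ _ _) (hm _ _ _)]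
  refine Finset.sum_congr rfl fun u' _ => ?_
  rw [covariance_const_mul_left, covariance_const_mul_right,
    IsGaussianProcess.covariance_centered_mul hY]
  simp only [covariance_eq_autocov hstat]

end StationaryGaussian

/-! ### Uniform error bounds and their summation. -/

section Asymptotic

variable {Ω : Type*} [MeasurableSpace Ω] {P : Measure Ω} {m : ℕ} {X : ℤ → Ω → (Fin m → ℝ)}

/-- At frequency zero the exponentials are `1`, and unconditional summability in `ℂ` is absolute. -/
theorem summable_norm_autocov {p : ℕ} (hA : AssumptionA X P p) (a b : Fin m) :
    Summable fun h : ℤ => ‖(autocov X P h a b : ℂ)‖ := by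
  have h := (hA a b).1 0
  simp only [Complex.ofReal_zero, mul_zero, zero_mul, Complex.exp_zero, one_mul] at h
  exact h.norm

theorem summable_abs_mul_norm_autocov (hA : AssumptionA X P 4) (a b : Fin m) :
    Summable fun h : ℤ => |(h : ℝ)| * ‖(autocov X P h a b : ℂ)‖ := by
  have hpi : (Real.pi : ℂ) ≠ 0 := by exact_mod_cast Real.pi_ne_zero
  refine summable_abs_mul_norm_of_contDiff (summable_norm_autocov hA a b)
    (g := fun w => (2 * (Real.pi : ℂ)) * specDensity X P w a b) (fun w => ?_) ?_
  · simp only [specDensity, Matrix.of_apply]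
    rw [mul_inv_cancel_left₀ (by simp [hpi])]
  · exact contDiff_const.mul ((hA a b).2.of_le (by norm_num))

theorem exists_norm_dftCov_sub_specDensity_le (hA : AssumptionA X P 4) :
    ∃ C : ℝ, 0 ≤ C ∧ ∀ (a b : Fin m) (n : ℕ), n ≠ 0 → ∀ s r : ℤ,
      ‖dftCov (fun h => (autocov X P h a b : ℂ)) n s r
        - if (n : ℤ) ∣ r - s then specDensity X P (fourierFreq n s) a b else 0‖
        ≤ C * (n : ℝ)⁻¹ := by
  have hp := Real.pi_pos
  let c : Fin m → Fin m → ℝ := fun a b =>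
    (2 * Real.pi)⁻¹ * ∑' h : ℤ, |(h : ℝ)| * ‖(autocov X P h a b : ℂ)‖
  have hc : ∀ a b, 0 ≤ c a b := fun a b =>
    mul_nonneg (by positivity) (tsum_nonneg fun h => by positivity)
  refine ⟨∑ a, ∑ b, c a b, Finset.sum_nonneg fun a _ => Finset.sum_nonneg fun b _ => hc a b,
    fun a b n hn s r => ?_⟩
  refine (norm_dftCov_sub_le (summable_norm_autocov hA a b)
    (summable_abs_mul_norm_autocov hA a b) hn s r).trans ?_
  refine mul_le_mul_of_nonneg_right ?_ (by positivity)
  calc c a b ≤ ∑ b, c a b :=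
        Finset.single_le_sum (f := fun b => c a b) (fun b _ => hc a b) (Finset.mem_univ b)
    _ ≤ _ := Finset.single_le_sum (f := fun a => ∑ b, c a b)
        (fun a _ => Finset.sum_nonneg fun b _ => hc a b) (Finset.mem_univ a)

theorem exists_norm_specDensity_le {p : ℕ} (hA : AssumptionA X P p) :
    ∃ B : ℝ, 0 ≤ B ∧ ∀ (w : ℝ) (a b : Fin m), ‖specDensity X P w a b‖ ≤ B := by
  have hp := Real.pi_pos
  let c : Fin m → Fin m → ℝ := fun a b =>
    (2 * Real.pi)⁻¹ * ∑' h : ℤ, ‖(autocov X P h a b : ℂ)‖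
  have hc : ∀ a b, 0 ≤ c a b := fun a b =>
    mul_nonneg (by positivity) (tsum_nonneg fun h => by positivity)
  refine ⟨∑ a, ∑ b, c a b, Finset.sum_nonneg fun a _ => Finset.sum_nonneg fun b _ => hc a b,
    fun w a b => ?_⟩
  have h1 : ‖specDensity X P w a b‖ ≤ c a b := by
    simp only [specDensity, Matrix.of_apply]
    rw [norm_mul]
    have h2 : ‖(2 * (Real.pi : ℂ))⁻¹‖ = (2 * Real.pi)⁻¹ := by
      simp [abs_of_pos hp]
    rw [h2]
    refine mul_le_mul_of_nonneg_left ?_ (by positivity)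
    exact tsum_of_norm_bounded (summable_norm_autocov hA a b).hasSum fun h => by
      simp [Complex.norm_exp]
  calc _ ≤ c a b := h1
    _ ≤ ∑ b, c a b :=
        Finset.single_le_sum (f := fun b => c a b) (fun b _ => hc a b) (Finset.mem_univ b)
    _ ≤ _ := Finset.single_le_sum (f := fun a => ∑ b, c a b)
        (fun a _ => Finset.sum_nonneg fun b _ => hc a b) (Finset.mem_univ a)

theorem specDensity_neg (hstat : IsStrictlyStationary X P) (w : ℝ) (a b : Fin m) :
    specDensity X P (-w) a b = specDensity X P w b a := by
  simp only [specDensity, Matrix.of_apply]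
  congr 1
  rw [← (Equiv.neg ℤ).tsum_eq]
  refine tsum_congr fun h => ?_
  simp [autocov_neg hstat]

theorem norm_mul_sub_mul_le {x y x' y' : ℂ} {e B : ℝ} (hx : ‖x - x'‖ ≤ e) (hy : ‖y - y'‖ ≤ e)
    (hx' : ‖x'‖ ≤ B) (hy' : ‖y'‖ ≤ B) : ‖x * y - x' * y'‖ ≤ e * (2 * B + e) := by
  have he : 0 ≤ e := (norm_nonneg _).trans hx
  have hB : 0 ≤ B := (norm_nonneg _).trans hx'
  have h : x * y - x' * y' = (x - x') * (y - y') + (x - x') * y' + x' * (y - y') := by ring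
  rw [h]
  calc _ ≤ ‖x - x'‖ * ‖y - y'‖ + ‖x - x'‖ * ‖y'‖ + ‖x'‖ * ‖y - y'‖ := by
        simpa only [norm_mul] using norm_add₃_le (a := (x - x') * (y - y'))
          (b := (x - x') * y') (c := x' * (y - y'))
    _ ≤ e * e + e * B + B * e := by gcongr
    _ = _ := by ring

theorem norm_quarter_sum_le {z : Fin 8 → ℂ} {d : ℝ} (hz : ∀ i, ‖z i‖ ≤ d) :
    ‖(1 / 4 : ℂ) * ∑ i, z i‖ ≤ 2 * d := by
  have h := norm_sum_le_of_le Finset.univ (fun i _ => hz i)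
  rw [Finset.sum_const, Finset.card_univ, Fintype.card_fin, nsmul_eq_mul] at h
  rw [norm_mul]
  have h4 : ‖(1 / 4 : ℂ)‖ = 1 / 4 := by norm_num
  rw [h4]
  push_cast at h
  linarith

theorem norm_quarter_form_le {a b c d : ℂ} {B : ℝ} (ha : ‖a‖ ≤ B) (hb : ‖b‖ ≤ B) (hc : ‖c‖ ≤ B)
    (hd : ‖d‖ ≤ B) : ‖(1 / 4 : ℂ) * (a ^ 2 + b ^ 2 + 2 * c * d)‖ ≤ B ^ 2 := by
  have hB0 : 0 ≤ B := (norm_nonneg _).trans ha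
  rw [norm_mul]
  have h4 : ‖(1 / 4 : ℂ)‖ = 1 / 4 := by norm_num
  have e1 : ‖a ^ 2‖ ≤ B ^ 2 := by
    rw [norm_pow]; exact pow_le_pow_left₀ (norm_nonneg _) ha 2
  have e2 : ‖b ^ 2‖ ≤ B ^ 2 := by
    rw [norm_pow]; exact pow_le_pow_left₀ (norm_nonneg _) hb 2
  have e3 : ‖2 * c * d‖ ≤ 2 * B * B := by
    rw [norm_mul, norm_mul, Complex.norm_ofNat]
    gcongr
  have := norm_add₃_le (a := a ^ 2) (b := b ^ 2) (c := 2 * c * d)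
  rw [h4]
  nlinarith

/-- Each of the eight products of transform covariances is replaced by its limit. Off the diagonal
both factors have limit zero, so the error is quadratic in `1/n`; on the diagonal it is linear. At
`2s = n` the frequencies `w_s` and `-w_s` coincide modulo `2π`, extra products survive, and only
boundedness is used. -/
theorem exists_norm_covariance_sub_le (hstat : IsStrictlyStationary X P)
    (hgauss : IsGaussianProcess X P) (hA : AssumptionA X P 4) (j k : Fin m) :
    ∃ C : ℝ, 0 ≤ C ∧ ∀ n : ℕ, n ≠ 0 → ∀ s r : ℤ, 1 ≤ s ∧ 2 * s ≤ n → 1 ≤ r ∧ 2 * r ≤ n →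
      ‖((covariance (fun ω => (periodogram (fun t => X t ω) n (fourierFreq n s) j k).re)
          (fun ω => (periodogram (fun t => X t ω) n (fourierFreq n r) j k).re) P : ℝ) : ℂ)
        - (if s = r then (1 / 4) * (specDensity X P (fourierFreq n s) j k ^ 2
            + specDensity X P (fourierFreq n s) k j ^ 2
            + 2 * specDensity X P (fourierFreq n s) j j * specDensity X P (fourierFreq n s) k k)
          else 0)‖
        ≤ C * ((n : ℝ)⁻¹ ^ 2
          + if s = r then (n : ℝ)⁻¹ + (if 2 * s = (n : ℤ) then 1 else 0) else 0) := by
  obtain ⟨C, hC0, hC⟩ := exists_norm_dftCov_sub_specDensity_le hA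
  obtain ⟨B, hB0, hB⟩ := exists_norm_specDensity_le hA
  -- The sum of the constants from three cases: `s ≠ r`, `s = r` with `2s ≠ n`, and `s = r` with `2s
  -- = n`.
  refine ⟨2 * C ^ 2 + 2 * (C * (2 * B + C)) + (2 * (C * (2 * B + C)) + 2 * B ^ 2 + B ^ 2),
    by positivity, fun n hn s r hs hr => ?_⟩
  have hnr : (1 : ℝ) ≤ n := by exact_mod_cast Nat.one_le_iff_ne_zero.mpr hn
  have hinv : (n : ℝ)⁻¹ ≤ 1 := inv_le_one_of_one_le₀ hnr
  have hinv0 : 0 < (n : ℝ)⁻¹ := by positivity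
  have hnd : ∀ d : ℤ, d ≠ 0 → |d| < n → ¬ (n : ℤ) ∣ d := fun d hd hlt hdvd =>
    hd (Int.eq_zero_of_abs_lt_dvd hdvd hlt)
  rw [covariance_re_periodogram hstat hgauss hn
    (hnd s (by omega) (by rw [abs_lt]; omega)) (hnd r (by omega) (by rw [abs_lt]; omega)),
    sum_cos_mul_cos_eq_dftCov (fun h => autocov X P h j j) (fun h => autocov X P h k k)
      (fun h => autocov X P h j k) (fun h => autocov X P h k j)]
  set K : Fin m → Fin m → ℤ → ℤ → ℂ := fun a b =>
    dftCov (fun h => (autocov X P h a b : ℂ)) n with hK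
  set L : Fin m → Fin m → ℤ → ℤ → ℂ := fun a b s r =>
    if (n : ℤ) ∣ r - s then specDensity X P (fourierFreq n s) a b else 0 with hL
  have hKL : ∀ a b s r, ‖K a b s r - L a b s r‖ ≤ C * (n : ℝ)⁻¹ := fun a b s r => hC a b n hn s r
  have hLB : ∀ a b s r, ‖L a b s r‖ ≤ B := by
    intro a b s r
    simp only [hL]
    split_ifs
    · exact hB _ _ _
    · simpa using hB0
  let Q : (Fin m → Fin m → ℤ → ℤ → ℂ) → Fin 8 → ℂ := fun K =>
    ![K j j s r * K k k (-s) (-r), K j j s (-r) * K k k (-s) r, K j j (-s) r * K k k s (-r),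
      K j j (-s) (-r) * K k k s r, K j k s r * K k j (-s) (-r), K j k s (-r) * K k j (-s) r,
      K j k (-s) r * K k j s (-r), K j k (-s) (-r) * K k j s r]
  have hQsum : ∀ K, ∑ i, Q K i = K j j s r * K k k (-s) (-r) + K j j s (-r) * K k k (-s) r
      + K j j (-s) r * K k k s (-r) + K j j (-s) (-r) * K k k s r
      + K j k s r * K k j (-s) (-r) + K j k s (-r) * K k j (-s) r
      + K j k (-s) r * K k j s (-r) + K j k (-s) (-r) * K k j s r := by
    intro K
    simp only [Fin.sum_univ_eight]
    rfl
  change ‖(1 / 4 : ℂ) * (K j j s r * K k k (-s) (-r) + K j j s (-r) * K k k (-s) r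
      + K j j (-s) r * K k k s (-r) + K j j (-s) (-r) * K k k s r
      + K j k s r * K k j (-s) (-r) + K j k s (-r) * K k j (-s) r
      + K j k (-s) r * K k j s (-r) + K j k (-s) (-r) * K k j s r) - _‖ ≤ _
  rw [← hQsum]
  -- The bound `B'` on the limits is left free: `B' = B` gives `O(1/n)` on the diagonal, `B' = 0`
  -- gives `O(n⁻²)` off it.
  have hdiff : ∀ B' : ℝ, (∀ a b, ∀ s' ∈ ({s, -s} : Set ℤ), ∀ r' ∈ ({r, -r} : Set ℤ),
      ‖L a b s' r'‖ ≤ B') →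
      ‖(1 / 4 : ℂ) * ∑ i, Q K i - (1 / 4 : ℂ) * ∑ i, Q L i‖
        ≤ 2 * (C * (n : ℝ)⁻¹ * (2 * B' + C * (n : ℝ)⁻¹)) := by
    intro B' hB'
    rw [← mul_sub, ← Finset.sum_sub_distrib]
    refine norm_quarter_sum_le fun i => ?_
    fin_cases i <;>
      exact norm_mul_sub_mul_le (hKL _ _ _ _) (hKL _ _ _ _) (hB' _ _ _ (by simp) _ (by simp))
        (hB' _ _ _ (by simp) _ (by simp))
  rcases eq_or_ne s r with rfl | hsr
  · have hd := hdiff B fun a b s' _ r' _ => hLB a b s' r'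
    have hd' : 2 * (C * (n : ℝ)⁻¹ * (2 * B + C * (n : ℝ)⁻¹))
        ≤ 2 * (C * (2 * B + C)) * (n : ℝ)⁻¹ := by
      have : C * (n : ℝ)⁻¹ ≤ C := mul_le_of_le_one_right hC0 hinv
      calc 2 * (C * (n : ℝ)⁻¹ * (2 * B + C * (n : ℝ)⁻¹))
          ≤ 2 * (C * (n : ℝ)⁻¹ * (2 * B + C)) := by gcongr
        _ = _ := by ring
    simp only [if_true]
    by_cases h2 : 2 * s = (n : ℤ)
    · rw [if_pos h2]
      have hQL : ‖(1 / 4 : ℂ) * ∑ i, Q L i‖ ≤ 2 * B ^ 2 := by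
        refine norm_quarter_sum_le fun i => ?_
        rw [pow_two]
        fin_cases i <;>
          exact (norm_mul_le _ _).trans
            (mul_le_mul (hLB _ _ _ _) (hLB _ _ _ _) (norm_nonneg _) hB0)
      set w := fourierFreq n s
      have hΦ : ‖(1 / 4 : ℂ) * (specDensity X P w j k ^ 2 + specDensity X P w k j ^ 2
            + 2 * specDensity X P w j j * specDensity X P w k k)‖ ≤ B ^ 2 :=
        norm_quarter_form_le (hB _ _ _) (hB _ _ _) (hB _ _ _) (hB _ _ _)
      have htri : ‖(1 / 4 : ℂ) * ∑ i, Q K i - (1 / 4 : ℂ) *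
          (specDensity X P w j k ^ 2 + specDensity X P w k j ^ 2
            + 2 * specDensity X P w j j * specDensity X P w k k)‖
          ≤ 2 * (C * (2 * B + C)) * (n : ℝ)⁻¹ + 2 * B ^ 2 + B ^ 2 := by
        refine (norm_sub_le _ _).trans (add_le_add ?_ hΦ)
        have := norm_le_norm_add_norm_sub' ((1 / 4 : ℂ) * ∑ i, Q K i) ((1 / 4 : ℂ) * ∑ i, Q L i)
        linarith
      refine htri.trans ?_
      have hCB : 0 ≤ C * (2 * B + C) := by positivity
      have h5 : C * (2 * B + C) * (n : ℝ)⁻¹ ≤ C * (2 * B + C) := mul_le_of_le_one_right hCB hinv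
      have h6 : (1 : ℝ) ≤ (n : ℝ)⁻¹ ^ 2 + ((n : ℝ)⁻¹ + 1) := by nlinarith
      calc 2 * (C * (2 * B + C)) * (n : ℝ)⁻¹ + 2 * B ^ 2 + B ^ 2
          ≤ (2 * C ^ 2 + 2 * (C * (2 * B + C)) + (2 * (C * (2 * B + C)) + 2 * B ^ 2 + B ^ 2)) * 1 := by
            nlinarith [sq_nonneg C]
        _ ≤ _ := mul_le_mul_of_nonneg_left h6 (by positivity)
    · rw [if_neg h2]
      have e0 : (n : ℤ) ∣ s - s := by simp
      have e1 : (n : ℤ) ∣ -s - -s := by simp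
      have e2 : ¬ (n : ℤ) ∣ -s - s := hnd _ (by omega) (by rw [abs_lt]; omega)
      have e3 : ¬ (n : ℤ) ∣ s - -s := hnd _ (by omega) (by rw [abs_lt]; omega)
      -- Only the four products pairing `s` with `s` and `-s` with `-s` survive; `f(-w) = f(w)'`
      -- turns them into the stated form.
      have hQL : ∑ i, Q L i = specDensity X P (fourierFreq n s) j k ^ 2
            + specDensity X P (fourierFreq n s) k j ^ 2
            + 2 * specDensity X P (fourierFreq n s) j j * specDensity X P (fourierFreq n s) k k := by
        rw [hQsum]
        simp only [hL, if_pos e0, if_pos e1, if_neg e2, if_neg e3, fourierFreq_neg,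
          specDensity_neg hstat]
        ring
      rw [← hQL]
      refine (hd.trans hd').trans ?_
      have hCB : 0 ≤ C * (2 * B + C) := by positivity
      rw [add_zero]
      refine mul_le_mul ?_ (by nlinarith) hinv0.le (by positivity)
      nlinarith [sq_nonneg C, sq_nonneg B]
  -- For distinct `s`, `r` in `[1, n/2]` the numbers `r ± s` are nonzero and smaller than `n` in
  -- absolute value.
  · have hL0 : ∀ a b, ∀ s' ∈ ({s, -s} : Set ℤ), ∀ r' ∈ ({r, -r} : Set ℤ), L a b s' r' = 0 := by
      intro a b s' hs' r' hr'
      simp only [hL]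
      refine if_neg (hnd _ ?_ ?_)
      · rcases hs' with rfl | rfl <;> rcases hr' with rfl | rfl <;> omega
      · rw [abs_lt]
        rcases hs' with rfl | rfl <;> rcases hr' with rfl | rfl <;> omega
    have hd := hdiff 0 fun a b s' hs' r' hr' => by rw [hL0 a b s' hs' r' hr', norm_zero]
    have hQL : ∑ i, Q L i = 0 := by
      rw [hQsum]
      simp [hL0]
    rw [hQL, mul_zero] at hd
    rw [if_neg hsr, if_neg hsr, add_zero]
    refine hd.trans ?_
    have hCB : 0 ≤ C * (2 * B + C) := by positivity
    calc 2 * (C * (n : ℝ)⁻¹ * (2 * 0 + C * (n : ℝ)⁻¹)) = 2 * C ^ 2 * (n : ℝ)⁻¹ ^ 2 := by ring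
      _ ≤ _ := by
        refine mul_le_mul_of_nonneg_right ?_ (by positivity)
        nlinarith [sq_nonneg B]

theorem not_dvd_of_bounds {n : ℕ} {s : ℤ} (hs : 1 ≤ s ∧ 2 * s ≤ n) : ¬ (n : ℤ) ∣ s := fun h => by
  have := Int.eq_zero_of_abs_lt_dvd h (by rw [abs_lt]; omega)
  omega

theorem bandwidth_le {δ : ℝ} (hδ1 : δ < 1 / 2) (n : ℕ) : bandwidth δ n ≤ n := by
  have := two_mul_bandwidth_le hδ1 n
  omega

theorem integral_olsEstimator_isBigO (hstat : IsStrictlyStationary X P)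
    (hgauss : IsGaussianProcess X P) (hA : AssumptionA X P 4) (j k : Fin m) {θ δ : ℝ}
    (hθ : θ = 0 ∨ θ = Real.pi) (hδ0 : 0 < δ) (hδ1 : δ < 1 / 2) :
    (fun n : ℕ => ∫ ω, olsEstimator (fun t => X t ω) θ δ j k n ∂P
      - (cMoment θ δ n 4 * GMoment (specDensity X P) θ δ j k n 0
          - cMoment θ δ n 2 * GMoment (specDensity X P) θ δ j k n 2)
        / (cMoment θ δ n 4 - cMoment θ δ n 2 ^ 2))
      =O[atTop] (fun n : ℕ => (n : ℝ)⁻¹) := by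
  have := hgauss.isProbabilityMeasure
  obtain ⟨C, hC0, hC⟩ := exists_norm_dftCov_sub_specDensity_le hA
  obtain ⟨A, hA0, hAev⟩ := exists_eventually_abs_olsWeight_le hθ hδ0 hδ1
  refine IsBigO.of_bound (A * C) ?_
  filter_upwards [hAev, eventually_ne_atTop 0] with n ha hn
  have hnr : (0 : ℝ) < n := by exact_mod_cast Nat.pos_of_ne_zero hn
  rw [← sum_olsWeight_mul_re]
  simp only [olsEstimator_eq_sum]
  rw [integral_finsetSum _ fun s _ =>
    ((memLp_re_periodogram hgauss n _ j k).integrable (by norm_num)).const_mul _,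
    ← Finset.sum_sub_distrib]
  have hterm : ∀ s ∈ regIndices θ δ n,
      ‖∫ ω, olsWeight θ δ n s * (periodogram (fun t => X t ω) n (fourierFreq n s) j k).re ∂P
        - olsWeight θ δ n s * (specDensity X P (fourierFreq n s) j k).re‖
      ≤ A * (n : ℝ)⁻¹ * (C * (n : ℝ)⁻¹) := by
    intro s hs
    rw [integral_const_mul, integral_re_periodogram hstat hgauss hn
      (not_dvd_of_bounds (bounds_of_mem_regIndices hδ1 hs)), ← mul_sub, norm_mul]
    refine mul_le_mul (ha s hs) ?_ (norm_nonneg _) (by positivity)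
    have h := hC j k n hn s s
    rw [if_pos (by simp)] at h
    rw [← Complex.sub_re]
    exact (Complex.abs_re_le_norm _).trans h
  have hsum := norm_sum_le_of_le _ hterm
  rw [Finset.sum_const, card_regIndices, nsmul_eq_mul] at hsum
  refine hsum.trans ?_
  calc (bandwidth δ n : ℝ) * (A * (n : ℝ)⁻¹ * (C * (n : ℝ)⁻¹))
      ≤ n * (A * (n : ℝ)⁻¹ * (C * (n : ℝ)⁻¹)) := by
        gcongr; exact bandwidth_le hδ1 n
    _ = A * C * (n : ℝ)⁻¹ := by field_simp
    _ = _ := by rw [Real.norm_of_nonneg (by positivity)]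

theorem variance_olsEstimator_eq (hgauss : IsGaussianProcess X P) (j k : Fin m) (θ δ : ℝ) (n : ℕ) :
    variance (fun ω => olsEstimator (fun t => X t ω) θ δ j k n) P
      = ∑ s ∈ regIndices θ δ n, ∑ r ∈ regIndices θ δ n, olsWeight θ δ n s * olsWeight θ δ n r *
        covariance (fun ω => (periodogram (fun t => X t ω) n (fourierFreq n s) j k).re)
          (fun ω => (periodogram (fun t => X t ω) n (fourierFreq n r) j k).re) P := by
  have := hgauss.isProbabilityMeasure
  rw [← covariance_self (memLp_olsEstimator hgauss θ δ j k n).aemeasurable]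
  have hm : ∀ s : ℤ, MemLp (fun ω => olsWeight θ δ n s *
      (periodogram (fun t => X t ω) n (fourierFreq n s) j k).re) 2 P := fun s =>
    (memLp_re_periodogram hgauss n _ j k).const_mul _
  simp only [olsEstimator_eq_sum]
  rw [covariance_fun_sum_fun_sum' (fun s _ => hm s) (fun s _ => hm s)]
  refine Finset.sum_congr rfl fun s _ => Finset.sum_congr rfl fun r _ => ?_
  rw [covariance_const_mul_left, covariance_const_mul_right, mul_assoc]

theorem norm_sum_olsWeight_sq_mul_le {θ δ A B : ℝ} {n : ℕ} (hn : n ≠ 0) (hB : 0 ≤ B)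
    (hδ1 : δ < 1 / 2)
    (ha : ∀ s ∈ regIndices θ δ n, |olsWeight θ δ n s| ≤ A * (n : ℝ)⁻¹) {Φ : ℤ → ℂ}
    (hΦ : ∀ s, ‖Φ s‖ ≤ B) :
    ‖∑ s ∈ regIndices θ δ n, (olsWeight θ δ n s : ℂ) ^ 2 * Φ s‖ ≤ A ^ 2 * B * (n : ℝ)⁻¹ := by
  have hnr : (0 : ℝ) < n := by exact_mod_cast Nat.pos_of_ne_zero hn
  have hterm : ∀ s ∈ regIndices θ δ n, ‖(olsWeight θ δ n s : ℂ) ^ 2 * Φ s‖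
      ≤ (A * (n : ℝ)⁻¹) ^ 2 * B := by
    intro s hs
    rw [norm_mul, norm_pow, Complex.norm_real]
    exact mul_le_mul (pow_le_pow_left₀ (norm_nonneg _) (ha s hs) 2) (hΦ s) (norm_nonneg _)
      (by positivity)
  have hsum := norm_sum_le_of_le _ hterm
  rw [Finset.sum_const, card_regIndices, nsmul_eq_mul] at hsum
  refine hsum.trans ?_
  calc (bandwidth δ n : ℝ) * ((A * (n : ℝ)⁻¹) ^ 2 * B) ≤ n * ((A * (n : ℝ)⁻¹) ^ 2 * B) := by
        gcongr; exact bandwidth_le hδ1 n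
    _ = _ := by field_simp

theorem norm_variance_olsEstimator_sub_le (hgauss : IsGaussianProcess X P) (j k : Fin m)
    {θ δ A C : ℝ} {n : ℕ} (hn : n ≠ 0) (hA : 0 ≤ A) (hC : 0 ≤ C) (hδ1 : δ < 1 / 2)
    (ha : ∀ s ∈ regIndices θ δ n, |olsWeight θ δ n s| ≤ A * (n : ℝ)⁻¹) {Φ : ℤ → ℂ}
    (hcov : ∀ s r : ℤ, 1 ≤ s ∧ 2 * s ≤ n → 1 ≤ r ∧ 2 * r ≤ n →
      ‖((covariance (fun ω => (periodogram (fun t => X t ω) n (fourierFreq n s) j k).re)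
          (fun ω => (periodogram (fun t => X t ω) n (fourierFreq n r) j k).re) P : ℝ) : ℂ)
        - (if s = r then Φ s else 0)‖
        ≤ C * ((n : ℝ)⁻¹ ^ 2
          + if s = r then (n : ℝ)⁻¹ + (if 2 * s = (n : ℤ) then 1 else 0) else 0)) :
    ‖((variance (fun ω => olsEstimator (fun t => X t ω) θ δ j k n) P : ℝ) : ℂ)
      - ∑ s ∈ regIndices θ δ n, (olsWeight θ δ n s : ℂ) ^ 2 * Φ s‖
      ≤ 3 * A ^ 2 * C * (n : ℝ)⁻¹ ^ 2 := by
  have hnr : (0 : ℝ) < n := by exact_mod_cast Nat.pos_of_ne_zero hn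
  set S := regIndices θ δ n with hS
  have hdiag : ∑ s ∈ S, (olsWeight θ δ n s : ℂ) ^ 2 * Φ s
      = ∑ s ∈ S, ∑ r ∈ S, (olsWeight θ δ n s : ℂ) * olsWeight θ δ n r
        * (if s = r then Φ s else 0) := by
    refine Finset.sum_congr rfl fun s hs => ?_
    simp only [mul_ite, mul_zero, Finset.sum_ite_eq, if_pos hs]
    ring
  rw [variance_olsEstimator_eq hgauss, hdiag]
  push_cast
  simp only [← hS, ← Finset.sum_sub_distrib, ← mul_sub]
  have hterm : ∀ s ∈ S, ∀ r ∈ S, ‖(olsWeight θ δ n s : ℂ) * olsWeight θ δ n r *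
      (((covariance (fun ω => (periodogram (fun t => X t ω) n (fourierFreq n s) j k).re)
          (fun ω => (periodogram (fun t => X t ω) n (fourierFreq n r) j k).re) P : ℝ) : ℂ)
        - (if s = r then Φ s else 0))‖
      ≤ (A * (n : ℝ)⁻¹) ^ 2 * (C * ((n : ℝ)⁻¹ ^ 2
          + if s = r then (n : ℝ)⁻¹ + (if 2 * s = (n : ℤ) then 1 else 0) else 0)) := by
    intro s hs r hr
    rw [norm_mul, norm_mul, Complex.norm_real, Complex.norm_real, pow_two (A * _)]
    refine mul_le_mul (mul_le_mul (ha s hs) (ha r hr) (norm_nonneg _) (by positivity))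
      (hcov s r (bounds_of_mem_regIndices hδ1 hs) (bounds_of_mem_regIndices hδ1 hr))
      (norm_nonneg _) (by positivity)
  refine (norm_sum_le_of_le S fun s hs => norm_sum_le_of_le S fun r hr => hterm s hs r hr).trans ?_
  have hcount : ∑ s ∈ S, (if 2 * s = (n : ℤ) then (1 : ℝ) else 0) ≤ 1 := by
    rw [Finset.sum_boole]
    have : (S.filter fun s => 2 * s = (n : ℤ)).card ≤ 1 := by
      rw [Finset.card_le_one]
      intro a ha b hb
      rw [Finset.mem_filter] at ha hb
      omega
    exact_mod_cast this
  have hcard : (S.card : ℝ) ≤ n := by rw [hS, card_regIndices]; exact_mod_cast bandwidth_le hδ1 n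
  -- One unit from all pairs, `(M/n)² ≤ 1`, one from the diagonal, `M/n ≤ 1`, and one from the at
  -- most one index with `2s = n`.
  have htot : ∑ s ∈ S, ∑ r ∈ S, ((n : ℝ)⁻¹ ^ 2
      + if s = r then (n : ℝ)⁻¹ + (if 2 * s = (n : ℤ) then 1 else 0) else 0) ≤ 3 := by
    have h1 : ∀ s ∈ S, ∑ r ∈ S, ((n : ℝ)⁻¹ ^ 2
        + if s = r then (n : ℝ)⁻¹ + (if 2 * s = (n : ℤ) then 1 else 0) else 0)
        = S.card * (n : ℝ)⁻¹ ^ 2 + ((n : ℝ)⁻¹ + (if 2 * s = (n : ℤ) then 1 else 0)) := by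
      intro s hs
      rw [Finset.sum_add_distrib, Finset.sum_const, nsmul_eq_mul, Finset.sum_ite_eq, if_pos hs]
    rw [Finset.sum_congr rfl h1, Finset.sum_add_distrib, Finset.sum_add_distrib, Finset.sum_const,
      Finset.sum_const, nsmul_eq_mul, nsmul_eq_mul]
    have e1 : (S.card : ℝ) * (n : ℝ)⁻¹ ≤ 1 := by
      rw [← div_eq_mul_inv, div_le_one hnr]; exact hcard
    have e0 : 0 ≤ (S.card : ℝ) * (n : ℝ)⁻¹ := by positivity
    have e2 : (S.card : ℝ) * (S.card * (n : ℝ)⁻¹ ^ 2) = (S.card * (n : ℝ)⁻¹) ^ 2 := by ring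
    rw [e2]
    nlinarith
  simp only [← Finset.mul_sum]
  calc (A * (n : ℝ)⁻¹) ^ 2 * (C * ∑ s ∈ S, ∑ r ∈ S, ((n : ℝ)⁻¹ ^ 2
      + if s = r then (n : ℝ)⁻¹ + (if 2 * s = (n : ℤ) then 1 else 0) else 0))
      ≤ (A * (n : ℝ)⁻¹) ^ 2 * (C * 3) := by gcongr
    _ = _ := by ring

theorem exists_eventually_norm_variance_sub_le (hstat : IsStrictlyStationary X P)
    (hgauss : IsGaussianProcess X P) (hA : AssumptionA X P 4) (j k : Fin m) {θ δ : ℝ}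
    (hθ : θ = 0 ∨ θ = Real.pi) (hδ0 : 0 < δ) (hδ1 : δ < 1 / 2) :
    ∃ C : ℝ, ∀ᶠ n : ℕ in atTop,
      ‖((variance (fun ω => olsEstimator (fun t => X t ω) θ δ j k n) P : ℝ) : ℂ)
          - (δ : ℂ)⁻¹ * (n : ℂ)⁻¹ *
            (((cMoment θ δ n 4 : ℂ) ^ 2 * FMoment (specDensity X P) θ δ j k n 0
              - 2 * (cMoment θ δ n 4 : ℂ) * (cMoment θ δ n 2 : ℂ)
                * FMoment (specDensity X P) θ δ j k n 2
                + (cMoment θ δ n 2 : ℂ) ^ 2 * FMoment (specDensity X P) θ δ j k n 4)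
              / (4 * ((cMoment θ δ n 4 : ℂ) - (cMoment θ δ n 2 : ℂ) ^ 2) ^ 2))‖
        ≤ C * (n : ℝ)⁻¹ ^ 2 := by
  obtain ⟨C, hC0, hC⟩ := exists_norm_covariance_sub_le hstat hgauss hA j k
  obtain ⟨B, hB0, hB⟩ := exists_norm_specDensity_le hA
  obtain ⟨A, hA0, hAev⟩ := exists_eventually_abs_olsWeight_le hθ hδ0 hδ1
  refine ⟨3 * A ^ 2 * C + δ⁻¹ * (A ^ 2 * B ^ 2), ?_⟩
  filter_upwards [hAev, eventually_ne_atTop 0, eventually_le_bandwidth hδ0] with n ha hn hband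
  have hnr : (0 : ℝ) < n := by exact_mod_cast Nat.pos_of_ne_zero hn
  have hMpos : (0 : ℝ) < bandwidth δ n := by
    have : 0 < δ * n := by positivity
    linarith
  have h1 := norm_variance_olsEstimator_sub_le hgauss j k hn hA0 hC0 hδ1 ha (hC n hn)
  have h2 := norm_sum_olsWeight_sq_mul_le hn (sq_nonneg B) hδ1 ha
    (Φ := fun s => (1 / 4) * (specDensity X P (fourierFreq n s) j k ^ 2
            + specDensity X P (fourierFreq n s) k j ^ 2
            + 2 * specDensity X P (fourierFreq n s) j j * specDensity X P (fourierFreq n s) k k))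
    (fun s => norm_quarter_form_le (hB _ _ _) (hB _ _ _) (hB _ _ _) (hB _ _ _))
  rw [sum_olsWeight_sq_mul] at h1 h2
  generalize (((cMoment θ δ n 4 : ℂ) ^ 2 * FMoment (specDensity X P) θ δ j k n 0
              - 2 * (cMoment θ δ n 4 : ℂ) * (cMoment θ δ n 2 : ℂ)
                * FMoment (specDensity X P) θ δ j k n 2
                + (cMoment θ δ n 2 : ℂ) ^ 2 * FMoment (specDensity X P) θ δ j k n 4)
              / (4 * ((cMoment θ δ n 4 : ℂ) - (cMoment θ δ n 2 : ℂ) ^ 2) ^ 2)) = Q at h1 h2 ⊢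
  generalize ((variance (fun ω => olsEstimator (fun t => X t ω) θ δ j k n) P : ℝ) : ℂ) = V at h1 ⊢
  have hMc : (bandwidth δ n : ℂ) ≠ 0 := by exact_mod_cast hMpos.ne'
  have hnc : (n : ℂ) ≠ 0 := by exact_mod_cast hn
  have hδc : (δ : ℂ) ≠ 0 := by exact_mod_cast hδ0.ne'
  -- Replacing `1/M` by `1/(δn)` changes `Q/M` by the relative amount `(δn - M)/(δn)`, at most
  -- `1/(δn)` because `M` is the integer part of `δn`. As `Q/M = O(1/n)`, the cost is `O(n⁻²)`.
  have hsplit : V - (δ : ℂ)⁻¹ * (n : ℂ)⁻¹ * Q = (V - (bandwidth δ n : ℂ)⁻¹ * Q)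
      + (((δ * n - bandwidth δ n) * (δ⁻¹ * (n : ℝ)⁻¹) : ℝ) : ℂ) * ((bandwidth δ n : ℂ)⁻¹ * Q) := by
    push_cast
    field_simp
    ring
  have hfl : |δ * n - bandwidth δ n| ≤ 1 := by
    have e1 : (bandwidth δ n : ℝ) ≤ δ * n := Nat.floor_le (by positivity)
    have e2 : δ * n < (bandwidth δ n : ℝ) + 1 := Nat.lt_floor_add_one _
    rw [abs_le]; constructor <;> linarith
  rw [hsplit]
  refine (norm_add_le _ _).trans ?_
  rw [add_mul]
  refine add_le_add h1 ?_
  rw [norm_mul (((_ : ℝ) : ℂ)), Complex.norm_real, norm_mul, Real.norm_eq_abs,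
    Real.norm_of_nonneg (by positivity : 0 ≤ δ⁻¹ * (n : ℝ)⁻¹)]
  calc |δ * n - bandwidth δ n| * (δ⁻¹ * (n : ℝ)⁻¹) * ‖(bandwidth δ n : ℂ)⁻¹ * Q‖
      ≤ 1 * (δ⁻¹ * (n : ℝ)⁻¹) * (A ^ 2 * B ^ 2 * (n : ℝ)⁻¹) := by gcongr
    _ = _ := by ring

end Asymptotic

end BoundarySpec

/-- Bias and variance of the ordinary least squares boundary estimator at `θ = 0` or `θ = π`, for a
fixed bandwidth fraction `δ`. The two expansions are stated in `ℂ` because `f` is complex valued.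
The first conjunct says that mean and variance are those of a square integrable variable. -/
theorem proposition4p1 {Ω : Type*} [MeasurableSpace Ω] (P : Measure Ω) [IsProbabilityMeasure P]
    (m : ℕ) (X : ℤ → Ω → (Fin m → ℝ))
    (hstat : BoundarySpec.IsStrictlyStationary X P)
    (hgauss : IsGaussianProcess X P)
    (hA : BoundarySpec.AssumptionA X P 4)
    (j k : Fin m) (θ : ℝ) (hθ : θ = 0 ∨ θ = Real.pi)
    (δ : ℝ) (hδ0 : 0 < δ) (hδ1 : δ < 1 / 2) :
    let f : ℝ → Matrix (Fin m) (Fin m) ℂ := BoundarySpec.specDensity X P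
    let est : ℕ → Ω → ℝ := fun n ω => BoundarySpec.olsEstimator (fun t => X t ω) θ δ j k n
    let c : ℕ → ℕ → ℝ := fun n q => BoundarySpec.cMoment θ δ n q
    let F : ℕ → ℕ → ℂ := fun n q => BoundarySpec.FMoment f θ δ j k n q
    let G : ℕ → ℕ → ℝ := fun n q => BoundarySpec.GMoment f θ δ j k n q
    (∀ n : ℕ, MemLp (est n) 2 P) ∧
    (fun n : ℕ =>
        ((variance (est n) P : ℝ) : ℂ)
          - (δ : ℂ)⁻¹ * (n : ℂ)⁻¹ *
            (((c n 4 : ℂ) ^ 2 * F n 0 - 2 * (c n 4 : ℂ) * (c n 2 : ℂ) * F n 2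
                + (c n 2 : ℂ) ^ 2 * F n 4)
              / (4 * ((c n 4 : ℂ) - (c n 2 : ℂ) ^ 2) ^ 2)))
      =o[atTop] (fun n : ℕ => (n : ℝ)⁻¹) ∧
    (fun n : ℕ =>
        (((∫ ω, est n ω ∂P : ℝ) : ℂ) - f θ j k)
          - ((((c n 4 * G n 0 - c n 2 * G n 2) / (c n 4 - c n 2 ^ 2) : ℝ) : ℂ) - f θ j k))
      =O[atTop] (fun n : ℕ => (n : ℝ)⁻¹) := by
  intro f est c F G
  refine ⟨fun n => BoundarySpec.memLp_olsEstimator hgauss θ δ j k n, ?_, ?_⟩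
  · obtain ⟨C, hC⟩ := BoundarySpec.exists_eventually_norm_variance_sub_le hstat hgauss hA j k hθ
      hδ0 hδ1
    have hO : (fun n : ℕ => (n : ℝ)⁻¹ ^ 2) =o[atTop] fun n : ℕ => (n : ℝ)⁻¹ := by
      have h1 : (fun n : ℕ => (n : ℝ)⁻¹) =o[atTop] fun _ : ℕ => (1 : ℝ) :=
        (isLittleO_one_iff ℝ).mpr tendsto_inv_atTop_nhds_zero_nat
      simpa [pow_two] using h1.mul_isBigO (isBigO_refl (fun n : ℕ => (n : ℝ)⁻¹) atTop)
    refine IsBigO.trans_isLittleO (IsBigO.of_bound C ?_) hO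
    filter_upwards [hC] with n hn
    rw [Real.norm_of_nonneg (by positivity)]
    exact hn
  · have h := BoundarySpec.integral_olsEstimator_isBigO hstat hgauss hA j k hθ hδ0 hδ1
    refine IsBigO.congr_left (Complex.isBigO_ofReal_left.mpr h) fun n => ?_
    rw [sub_sub_sub_cancel_right, ← Complex.ofReal_sub]
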